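/- **Theorem (Liveness of AlterBFT).** *System.* There are $n$ replicas, of which at most $f$ are Byzantine, $n>2f$; the others are honest. Signatures of honest replicas cannot be forged. A block is a pair (payload, hash of the predecessor block or nil); the hash function $id$ is injective and no block is its own proper ancestor. A message broadcast by an honest replica at time $t$ is received by every honest replica at time at most $t+\Delta_S$ if it is small (votes, silence messages, certificates), and at most $\max\{t,GST\}+\Delta_L$ if it carries a block (proposals), where $0<\Delta_S\le\Delta_L$. All honest replicas start within $\Delta_S$ time of each other, local clocks run at the same speed, local computation takes no time, only finitely many events happen in bounded time, received messages are kept, and messages that are due at the time when a timer expires are handled before the timer. The payload an honest replica obtains, for a predecessor that is nil or a valid block, makes a valid block. *Protocol.* Epochs are $0,1,2,\dots$; epoch $e$ has a leader $\mathrm{leader}(e)$. Each replica keeps a most recent block certificate $lockedBC$ (initially nil); a block certificate of epoch $e$ consists of $f+1$ votes of epoch $e$ by distinct replicas for the same block hash, a silence certificate of $f+1$ silence messages of epoch $e$ by distinct replicas, an equivocation certificate of two votes of epoch $e$ signed by its leader for different hashes. - On starting epoch $e$, a replica marks it active and starts $timeoutCertificate(e)=\Delta_L+4\Delta_S$. The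 leader proposes at once if $e=0$ or its $lockedBC$ is from epoch $e-1$, and otherwise when $timeoutEpochChange(e)=2\Delta_S$ expires. To propose is to broadcast a new block that extends the block of $lockedBC$, together with $lockedBC$, and a signed vote for its hash. - A replica in the active epoch $e$ that has not voted in it, and has received a proposal $(b,BC)$ of epoch $e$ and the leader's vote for $id(b)$, votes for $b$ and forwards both messages, if $b$ is valid, the predecessor of $b$ is the block certified by $BC$ (none if $BC$ is nil), and its $lockedBC$ is nil or not more recent than $BC$. - A replica in epoch $e$ that holds a block certificate of epoch $e$ locks on it, starts $timeoutCommit(e)=2\Delta_S$ for its hash if epoch $e$ is active, broadcasts the certificate and starts epoch $e+1$. The leader of the current epoch that holds a block certificate of another epoch, more recent than its $lockedBC$, locks on it and broadcasts it. - A replica that holds a silence or equivocation certificate of an active epoch marks that epoch not-committed; if it is its current epoch, it broadcasts the certificate and starts epoch $e+1$ after $2\Delta_S$ if it is then still in epoch $e$. - If $timeoutCertificate(e)$ expires while the replica is in $e$ and $e$ is active, it broadcasts a silence message. - If $timeoutCommit(e)$ for a hash expires, or votes of epoch $e$ for a hash from all replicas have been received, while $e$ is active, the replica marks $e$ committed with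 that hash as decision; once it has received a proposal of epoch $e$ for a block with that hash, it commits this block and all its ancestors. *Claim.* In every execution: 1. In every epoch $e$ with an honest leader such that no honest replica starts $e$ before $GST$, the leader proposes a block, and every honest replica commits, with epoch $e$ as the deciding epoch, the block that the leader proposes in $e$. 2. If infinitely many epochs have an honest leader, then all honest replicas keep committing new blocks: for every honest replica $p$ and every time $T$, at some time at least $T$ the replica $p$ commits a block that it had not committed before. -/

import Mathlib

open Filter

namespace AlterBFT

/-! ### Blocks, certificates, messages -/

/-- A block: a payload and the hash of its predecessor (`none` for a first block). -/
structure Block (Payload Id : Type*) where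
  payload : Payload
  prev : Option Id

/-- A block certificate `C_e(B)`: signatures of the replicas in `signers` on the vote for the block
hash `id` in epoch `epoch`. -/
structure BlockCert (R Id : Type*) where
  epoch : ℕ
  id : Id
  signers : Finset R

/-- The three kinds of certificates. `silence e S` holds signatures of the members of `S` on the
silence message of epoch `e`; `equiv e h h'` holds two votes of epoch `e`, for `h` and `h'`, signed
by the leader of epoch `e`. -/
inductive Cert (R Id : Type*) where
  | block (c : BlockCert R Id)
  | silence (e : ℕ) (signers : Finset R)
  | equiv (e : ℕ) (h h' : Id)

/-- The messages of the protocol; `vote` and `silence` carry the name of their signer. -/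
inductive Msg (R Payload Id : Type*) where
  | propose (e : ℕ) (b : Block Payload Id) (bc : Option (BlockCert R Id))
  | vote (e : ℕ) (h : Id) (signer : R)
  | silence (e : ℕ) (signer : R)
  | quitEpoch (c : Cert R Id)

/-- Messages of type L are the ones that carry a block; all others are of type S. -/
def Msg.IsLarge {R Payload Id : Type*} : Msg R Payload Id → Prop
  | .propose _ _ _ => True
  | _ => False

/-- The epoch of a certificate. -/
def Cert.epoch {R Id : Type*} : Cert R Id → ℕ
  | .block c => c.epoch
  | .silence e _ => e
  | .equiv e _ _ => e

/-- State of an epoch at a replica. -/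
inductive EpochStatus where
  | active
  | committed
  | notCommitted

/-- Timers: `timeoutEpochChange(e)`, `timeoutCertificate(e)` and `timeoutCommit(e, h)`, where
`h = none` stands for the special value nil. -/
inductive Timer (Id : Type*) where
  | epochChange (e : ℕ)
  | certificate (e : ℕ)
  | commit (e : ℕ) (h : Option Id)

/-! ### Parameters of the protocol -/

/-- The parameters: the bound `f` on the number of faulty replicas, the leader of each epoch, the
hash function, the external validity predicate, the payload that a replica gets when it has to
propose in an epoch a block with a given predecessor, and the two delay bounds. -/
structure Protocol (R Payload Id : Type*) where
  f : ℕ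
  leader : ℕ → R
  id : Block Payload Id → Id
  valid : Block Payload Id → Prop
  getPayload : R → ℕ → Option Id → Payload
  ΔS : ℝ
  ΔL : ℝ

/-- The local state of a replica. `outbox` records the messages that it has broadcast, with the time
of the broadcast; `timers` holds the running timers, with the time at which they expire; messages
that have been received are kept for ever. -/
structure LocalState (R Payload Id : Type*) where
  started : Bool
  epoch : ℕ
  hasVoted : Bool
  lockedBC : Option (BlockCert R Id)
  status : ℕ → Option EpochStatus
  decision : ℕ → Option Id
  committed : Set (Block Payload Id)
  timers : Set (Timer Id × ℝ)
  received : Set (Msg R Payload Id)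
  outbox : Set (Msg R Payload Id × ℝ)

namespace LocalState

variable {R Payload Id : Type*}

/-- The initial state, before bootstrapping. -/
def init : LocalState R Payload Id where
  started := false
  epoch := 0
  hasVoted := false
  lockedBC := none
  status := fun _ => none
  decision := fun _ => none
  committed := ∅
  timers := ∅
  received := ∅
  outbox := ∅

/-- Broadcast `m` to all replicas, the sender included. -/
def broadcast (s : LocalState R Payload Id) (now : ℝ) (m : Msg R Payload Id) :
    LocalState R Payload Id :=
  { s with outbox := insert (m, now) s.outbox }

/-- Start the timer `τ` with duration `d`. -/
def startTimer (s : LocalState R Payload Id) (now : ℝ) (τ : Timer Id) (d : ℝ) :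
    LocalState R Payload Id :=
  { s with timers := insert (τ, now + d) s.timers }

/-- Receive `m`. -/
def receive (s : LocalState R Payload Id) (m : Msg R Payload Id) : LocalState R Payload Id :=
  { s with received := insert m s.received }

end LocalState

namespace Protocol

variable {R Payload Id : Type*} (P : Protocol R Payload Id)

def timeoutEpochChange : ℝ := 2 * P.ΔS

def timeoutCertificate : ℝ := P.ΔL + 4 * P.ΔS

def timeoutCommit : ℝ := 2 * P.ΔS

/-- `a` is the predecessor of `b`. -/
def Parent (a b : Block Payload Id) : Prop := b.prev = some (P.id a)

/-- `b` extends `a`: `a` is `b` or an ancestor of `b`. -/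
def Extends (b a : Block Payload Id) : Prop := Relation.ReflTransGen P.Parent a b

/-- Time by which a message sent at time `t` between honest replicas is received. -/
noncomputable def deadline (GST : ℝ) (m : Msg R Payload Id) (t : ℝ) : ℝ :=
  open Classical in if m.IsLarge then max t GST + P.ΔL else t + P.ΔS

/-! ### Procedures -/

/-- `getBlock()`: a block that extends the block of `lockedBC`. -/
def getBlock (p : R) (s : LocalState R Payload Id) : Block Payload Id :=
  { payload := P.getPayload p s.epoch (s.lockedBC.map BlockCert.id)
    prev := s.lockedBC.map BlockCert.id }

/-- `Propose()`. -/
def propose (p : R) (now : ℝ) (s : LocalState R Payload Id) : LocalState R Payload Id :=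
  { (s.broadcast now (.propose s.epoch (P.getBlock p s) s.lockedBC)).broadcast now
      (.vote s.epoch (P.id (P.getBlock p s)) p) with
    hasVoted := true }

/-- The assignments at the start of `StartEpoch(e)`, and the start of `timeoutCertificate(e)`. -/
def enterEpoch (now : ℝ) (e : ℕ) (s : LocalState R Payload Id) : LocalState R Payload Id :=
  { s.startTimer now (.certificate e) P.timeoutCertificate with
    started := true
    epoch := e
    hasVoted := false
    status := Function.update s.status e (some .active)
    decision := Function.update s.decision e none }

open Classical in
/-- `StartEpoch(e)`. -/
noncomputable def startEpoch (p : R) (now : ℝ) (e : ℕ) (s : LocalState R Payload Id) :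
    LocalState R Payload Id :=
  if P.leader e = p then
    if e = 0 ∨ ∃ c ∈ s.lockedBC, c.epoch + 1 = e then
      P.propose p now (P.enterEpoch now e s)
    else
      (P.enterEpoch now e s).startTimer now (.epochChange e) P.timeoutEpochChange
  else P.enterEpoch now e s

/-- Reaction to an acceptable proposal: vote, forward the leader's vote and the proposal. -/
def castVote (p : R) (now : ℝ) (b : Block Payload Id) (bc : Option (BlockCert R Id))
    (s : LocalState R Payload Id) : LocalState R Payload Id :=
  { ((s.broadcast now (.vote s.epoch (P.id b) p)).broadcast now
      (.vote s.epoch (P.id b) (P.leader s.epoch))).broadcast now (.propose s.epoch b bc) with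
    hasVoted := true }

open Classical in
/-- Reaction to a block certificate of the current epoch: lock, start `timeoutCommit` if the epoch
is still active, broadcast the certificate, and start the next epoch. -/
noncomputable def lockAndAdvance (p : R) (now : ℝ) (c : BlockCert R Id)
    (s : LocalState R Payload Id) : LocalState R Payload Id :=
  let s₁ : LocalState R Payload Id := { s with lockedBC := some c }
  let s₂ := if s.status s.epoch = some .active then
    s₁.startTimer now (.commit s.epoch (some c.id)) P.timeoutCommit else s₁
  P.startEpoch p now (s.epoch + 1) (s₂.broadcast now (.quitEpoch (.block c)))

open Classical in
/-- `MisbehaviorDetected(c)` for an epoch that is still active. -/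
noncomputable def misbehaviorDetected (now : ℝ) (c : Cert R Id) (s : LocalState R Payload Id) :
    LocalState R Payload Id :=
  let s₁ : LocalState R Payload Id :=
    { s with status := Function.update s.status c.epoch (some .notCommitted) }
  if c.epoch = s.epoch then
    (s₁.broadcast now (.quitEpoch c)).startTimer now (.commit c.epoch none) P.timeoutCommit
  else s₁

/-- Both commit rules: epoch `e` is committed with decision `h`. -/
def decideEpoch (e : ℕ) (h : Id) (s : LocalState R Payload Id) : LocalState R Payload Id :=
  { s with
    status := Function.update s.status e (some .committed)
    decision := Function.update s.decision e (some h) }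

/-- `CommitBlock(b)`: commit `b` and all its predecessors. -/
def commitBlock (b : Block Payload Id) (s : LocalState R Payload Id) : LocalState R Payload Id :=
  { s with committed := s.committed ∪ {a | P.Extends b a} }

/-! ### Certificates known to a replica -/

/-- A block certificate has signatures of at least `f + 1` distinct replicas. -/
def WellFormed (c : BlockCert R Id) : Prop := P.f + 1 ≤ c.signers.card

/-- The replica holds the block certificate `c`: it has received it in a quit-epoch message, or it
has received the votes that make it up. -/
def HasBlockCert (s : LocalState R Payload Id) (c : BlockCert R Id) : Prop :=
  P.WellFormed c ∧
    (.quitEpoch (.block c) ∈ s.received ∨ ∀ q ∈ c.signers, .vote c.epoch c.id q ∈ s.received)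

/-- The replica holds the silence or equivocation certificate `c`: it has received it in a
quit-epoch message, or it has received the messages that make it up. -/
def HasMisbehaviorCert (s : LocalState R Payload Id) : Cert R Id → Prop
  | .block _ => False
  | .silence e S => P.f + 1 ≤ S.card ∧
      (.quitEpoch (.silence e S) ∈ s.received ∨ ∀ q ∈ S, .silence e q ∈ s.received)
  | .equiv e h h' => h ≠ h' ∧
      (.quitEpoch (.equiv e h h') ∈ s.received ∨
        (.vote e h (P.leader e) ∈ s.received ∧ .vote e h' (P.leader e) ∈ s.received))

/-- The validity check for a proposal `(b, bc)`: `b` satisfies the external predicate, and its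
predecessor is the block certified by `bc` (or there is none, and `bc` is nil). -/
def ValidProposal (b : Block Payload Id) (bc : Option (BlockCert R Id)) : Prop :=
  P.valid b ∧ b.prev = bc.map BlockCert.id ∧ ∀ c ∈ bc, P.WellFormed c

/-! ### The rules triggered by messages -/

/-- `P.Reaction p now s s'`: some `when receive ...` rule of replica `p` is enabled in state `s`, and
executing it at time `now` leads to `s'`. -/
inductive Reaction (p : R) (now : ℝ) (s : LocalState R Payload Id) :
    LocalState R Payload Id → Prop
  | vote (b : Block Payload Id) (bc : Option (BlockCert R Id))
      (hstart : s.started = true)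
      (hprop : .propose s.epoch b bc ∈ s.received)
      (hvote : .vote s.epoch (P.id b) (P.leader s.epoch) ∈ s.received)
      (hact : s.status s.epoch = some .active)
      (hvalid : P.ValidProposal b bc)
      (hnew : s.hasVoted = false)
      (hcond : s.lockedBC = none ∨
        ∃ c₀ c, s.lockedBC = some c₀ ∧ bc = some c ∧ c₀.epoch ≤ c.epoch) :
      Reaction p now s (P.castVote p now b bc s)
  | blockCert (c : BlockCert R Id)
      (hstart : s.started = true)
      (hcert : P.HasBlockCert s c)
      (hepoch : c.epoch = s.epoch) :
      Reaction p now s (P.lockAndAdvance p now c s)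
  | blockCertLeader (c : BlockCert R Id)
      (hstart : s.started = true)
      (hcert : P.HasBlockCert s c)
      (hepoch : c.epoch ≠ s.epoch)
      (hleader : P.leader s.epoch = p)
      (hrecent : ∀ c₀ ∈ s.lockedBC, c₀.epoch < c.epoch) :
      Reaction p now s
        (LocalState.broadcast { s with lockedBC := some c } now (.quitEpoch (.block c)))
  | fastCommit (e : ℕ) (h : Id)
      (hstart : s.started = true)
      (hvotes : ∀ q : R, .vote e h q ∈ s.received)
      (hact : s.status e = some .active) :
      Reaction p now s (decideEpoch e h s)
  | commitBlock (e : ℕ) (b : Block Payload Id) (bc : Option (BlockCert R Id))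
      (hstart : s.started = true)
      (hprop : .propose e b bc ∈ s.received)
      (hdec : s.decision e = some (P.id b))
      (hnew : b ∉ s.committed) :
      Reaction p now s (P.commitBlock b s)
  | misbehavior (c : Cert R Id)
      (hstart : s.started = true)
      (hcert : P.HasMisbehaviorCert s c)
      (hact : s.status c.epoch = some .active) :
      Reaction p now s (P.misbehaviorDetected now c s)

/-- Some rule triggered by messages is enabled. -/
def Enabled (p : R) (now : ℝ) (s : LocalState R Payload Id) : Prop := ∃ s', P.Reaction p now s s'

/-! ### The rules triggered by timers -/

open Classical in
/-- The effect of the expiration of a timer. -/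
noncomputable def onTimeout (p : R) (now : ℝ) (s : LocalState R Payload Id) :
    Timer Id → LocalState R Payload Id
  | .epochChange e => if s.epoch = e then P.propose p now s else s
  | .certificate e =>
      if s.epoch = e ∧ s.status e = some .active then s.broadcast now (.silence e p) else s
  | .commit e (some h) => if s.status e = some .active then decideEpoch e h s else s
  | .commit e none => if s.epoch = e then P.startEpoch p now (e + 1) s else s

/-- Remove the expired timer and execute its rule. -/
noncomputable def timeoutStep (p : R) (now : ℝ) (τ : Timer Id) (s : LocalState R Payload Id) :
    LocalState R Payload Id :=
  P.onTimeout p now { s with timers := s.timers \ {(τ, now)} } τ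

end Protocol

/-! ### Executions in the hybrid synchronous model -/

/-- Events. `idle` does not concern any honest replica. -/
inductive Event (R Payload Id : Type*) where
  | idle
  | bootstrap (p : R)
  | receive (p : R) (m : Msg R Payload Id)
  | react (p : R)
  | timeout (p : R) (τ : Timer Id)

/-- The replica at which an event takes place. -/
def Event.actor {R Payload Id : Type*} : Event R Payload Id → Option R
  | .idle => none
  | .bootstrap p => some p
  | .receive p _ => some p
  | .react p => some p
  | .timeout p _ => some p

section Signatures

variable {R Payload Id : Type*} (P : Protocol R Payload Id) (honest : Set R)
  (state : R → LocalState R Payload Id)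

/-- The signature of `q` on the vote for `h` in epoch `e` is available: signatures of honest replicas
cannot be forged, those of faulty replicas are at the disposal of the adversary. -/
def VoteSigned (e : ℕ) (h : Id) (q : R) : Prop :=
  q ∈ honest → ∃ t, (.vote e h q, t) ∈ (state q).outbox

/-- The signature of `q` on the silence message of epoch `e` is available. -/
def SilenceSigned (e : ℕ) (q : R) : Prop :=
  q ∈ honest → ∃ t, (.silence e q, t) ∈ (state q).outbox

/-- All signatures in a certificate are available. -/
def CertSigned : Cert R Id → Prop
  | .block c => ∀ q ∈ c.signers, VoteSigned honest state c.epoch c.id q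
  | .silence e S => ∀ q ∈ S, SilenceSigned honest state e q
  | .equiv e h h' =>
      VoteSigned honest state e h (P.leader e) ∧ VoteSigned honest state e h' (P.leader e)

/-- All signatures in a message are available. Proposals themselves are not signed. -/
def Authentic : Msg R Payload Id → Prop
  | .propose _ _ bc => ∀ c ∈ bc, CertSigned P honest state (.block c)
  | .vote e h q => VoteSigned honest state e h q
  | .silence e q => SilenceSigned honest state e q
  | .quitEpoch c => CertSigned P honest state c

end Signatures

/-- An execution of the protocol, as a sequence of events: event `i` takes place at time `time i` and
leads from `state i` to `state (i + 1)`. The states of faulty replicas are irrelevant; faulty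
replicas act by having any messages with available signatures delivered at any times. -/
structure Execution {R Payload Id : Type*} (P : Protocol R Payload Id) (honest : Set R)
    (GST : ℝ) where
  time : ℕ → ℝ
  event : ℕ → Event R Payload Id
  state : ℕ → R → LocalState R Payload Id
  time_mono : Monotone time
  time_tendsto : Tendsto time atTop atTop
  state_zero : ∀ p ∈ honest, state 0 p = LocalState.init
  /-- A replica changes its state only in its own events. -/
  frame : ∀ i, ∀ p ∈ honest, (event i).actor ≠ some p → state (i + 1) p = state i p
  bootstrap_step : ∀ i, ∀ p ∈ honest, event i = .bootstrap p →
    (state i p).started = false ∧ state (i + 1) p = P.startEpoch p (time i) 0 (state i p)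
  receive_step : ∀ i, ∀ p ∈ honest, ∀ m, event i = .receive p m →
    Authentic P honest (state i) m ∧ state (i + 1) p = (state i p).receive m
  react_step : ∀ i, ∀ p ∈ honest, event i = .react p →
    P.Reaction p (time i) (state i p) (state (i + 1) p)
  timeout_step : ∀ i, ∀ p ∈ honest, ∀ τ, event i = .timeout p τ →
    (τ, time i) ∈ (state i p).timers ∧ state (i + 1) p = P.timeoutStep p (time i) τ (state i p)
  /-- Local computation takes no time: time does not advance while a rule is enabled. -/
  urgent : ∀ i, ∀ p ∈ honest, P.Enabled p (time i) (state (i + 1) p) → time (i + 1) = time i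
  /-- Time does not advance beyond the expiration of a timer. -/
  timer_due : ∀ i, ∀ p ∈ honest, ∀ τ x, (τ, x) ∈ (state i p).timers → time i ≤ x
  /-- Messages between honest replicas are received by their deadline. -/
  delivery : ∀ i, ∀ p ∈ honest, ∀ q ∈ honest, ∀ m t, (m, t) ∈ (state i p).outbox →
    P.deadline GST m t < time i → m ∈ (state i q).received
  /-- A timer that expires at time `x` is handled after the messages whose deadline is at most
  `x` have been received ... -/
  delivery_before_timeout : ∀ i, ∀ p ∈ honest, ∀ q ∈ honest, ∀ m t τ,
    (m, t) ∈ (state i p).outbox → event i = .timeout q τ → P.deadline GST m t ≤ time i →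
    m ∈ (state i q).received
  /-- ... and after the rules triggered by received messages have been executed. -/
  react_before_timeout : ∀ i, ∀ p ∈ honest, ∀ τ, event i = .timeout p τ →
    ¬ P.Enabled p (time i) (state i p)
  /-- All honest replicas start the execution within `Δ_S` time. -/
  start : ∃ t₀, ∀ p ∈ honest, ∃ i, event i = .bootstrap p ∧ t₀ ≤ time i ∧ time i ≤ t₀ + P.ΔS

namespace Execution

variable {R Payload Id : Type*} {P : Protocol R Payload Id} {honest : Set R} {GST : ℝ}
  (X : Execution P honest GST)

/-- Replica `p` is in epoch `e` just before event `i`. -/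
def InEpoch (p : R) (e i : ℕ) : Prop := (X.state i p).started = true ∧ (X.state i p).epoch = e

/-- Replica `p` starts epoch `e` in event `i`. -/
def StartsEpoch (p : R) (e i : ℕ) : Prop := ¬ X.InEpoch p e i ∧ X.InEpoch p e (i + 1)

/-- Epoch `e` is after GST: no honest replica starts it before GST. -/
def AfterGST (e : ℕ) : Prop := ∀ p ∈ honest, ∀ i, X.StartsEpoch p e i → GST ≤ X.time i

/-- Replica `p` broadcasts a proposal for block `b` in epoch `e`. -/
def Proposes (p : R) (e : ℕ) (b : Block Payload Id) : Prop :=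
  ∃ i bc t, (.propose e b bc, t) ∈ (X.state i p).outbox

/-- Replica `p` commits block `b` in epoch `e`: its decision for epoch `e` is the hash of `b`, and
`b` is among its committed blocks. -/
def CommitsIn (p : R) (e : ℕ) (b : Block Payload Id) : Prop :=
  ∃ i, (X.state i p).decision e = some (P.id b) ∧ b ∈ (X.state i p).committed

/-- In event `i` replica `p` commits the block `b`, which it had not committed before. -/
def CommitsNew (p : R) (b : Block Payload Id) (i : ℕ) : Prop :=
  b ∉ (X.state i p).committed ∧ b ∈ (X.state (i + 1) p).committed

end Execution

end AlterBFT

/-!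
Whatever makes an honest replica leave an epoch is a certificate that it broadcasts, so honest
replicas start every epoch within `ΔS` of each other. They cannot all stay in an epoch forever,
since then their silence messages would form a certificate.

Consider an epoch with an honest leader that starts after `GST`. By waiting `2 ΔS`, the leader
learns the locks of all honest replicas, so every one of them accepts its proposal, and the
resulting `f + 1` votes reach everyone before a first silence message could be sent. The honest
leader does not equivocate either, so no certificate against the epoch ever exists. Hence each
honest replica leaves the epoch with a block certificate, necessarily for the block of the leader,
and decides that block at the latest when `timeoutCommit` expires.

All honest replicas are then locked on a certificate at least as recent, so every block that an
honest replica votes for in a later epoch extends this block. By acyclicity the blocks of infinitely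
many such epochs are distinct, whereas at any given time only finitely many hashes have received an
honest vote, and hence only finitely many blocks can have been committed.
-/

namespace AlterBFT

variable {R Payload Id : Type*}

theorem exists_lt_not_and_succ {Q : ℕ → Prop} {i : ℕ} (hzero : ¬ Q 0) (hi : Q i) :
    ∃ k < i, ¬ Q k ∧ Q (k + 1) := by
  induction i with
  | zero => exact absurd hi hzero
  | succ i ih =>
    by_cases h : Q i
    · obtain ⟨k, hk, hQ⟩ := ih h
      exact ⟨k, hk.trans i.lt_succ_self, hQ⟩
    · exact ⟨i, i.lt_succ_self, h, hi⟩

/-- The replica has started epoch `e`, which it may have left since. -/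
def LocalState.Reached (s : LocalState R Payload Id) (e : ℕ) : Prop :=
  s.started = true ∧ e ≤ s.epoch

theorem LocalState.Reached.of_le {s : LocalState R Payload Id} {e e' : ℕ} (h : s.Reached e)
    (he : e' ≤ e) : s.Reached e' :=
  ⟨h.1, he.trans h.2⟩

theorem LocalState.Reached.succ_or_epoch_eq {s : LocalState R Payload Id} {e : ℕ}
    (h : s.Reached e) : s.Reached (e + 1) ∨ s.epoch = e :=
  h.2.lt_or_eq.imp (fun hlt => ⟨h.1, hlt⟩) Eq.symm

/-- The bound on the number of Byzantine replicas, where `honest` is the set of the others. -/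
structure HonestMajority [Fintype R] (P : Protocol R Payload Id) (honest : Set R) : Prop where
  two_mul_lt : 2 * P.f < Fintype.card R
  ncard_compl_le : honestᶜ.ncard ≤ P.f

namespace HonestMajority

variable [Fintype R] {P : Protocol R Payload Id} {honest : Set R}

theorem f_lt_card (hM : HonestMajority P honest) : P.f + 1 ≤ Fintype.card R := by
  have := hM.two_mul_lt
  lia

theorem exists_mem_honest (hM : HonestMajority P honest) {S : Finset R} (hS : P.f + 1 ≤ S.card) :
    ∃ q ∈ S, q ∈ honest := by
  by_contra! hbad
  have hcard : (S : Set R).ncard ≤ honestᶜ.ncard := Set.ncard_le_ncard hbad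
  rw [Set.ncard_coe_finset] at hcard
  have := hM.ncard_compl_le
  lia

theorem f_lt_card_honest (hM : HonestMajority P honest) :
    P.f + 1 ≤ honest.toFinite.toFinset.card := by
  have hcard := Set.ncard_add_ncard_compl honest
  rw [Nat.card_eq_fintype_card, Set.ncard_eq_toFinset_card honest] at hcard
  have := hM.ncard_compl_le
  have := hM.two_mul_lt
  lia

end HonestMajority

/-- The assumptions on the system under which honest replicas agree on the block of an epoch with an
honest leader. -/
structure Assumptions [Fintype R] (P : Protocol R Payload Id) (honest : Set R) : Prop
    extends HonestMajority P honest where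
  ΔS_pos : 0 < P.ΔS
  ΔS_le : P.ΔS ≤ P.ΔL
  id_injective : Function.Injective P.id
  payload : ∀ p ∈ honest, ∀ e prev, (∀ h ∈ prev, ∃ a, P.valid a ∧ P.id a = h) →
    P.valid ⟨P.getPayload p e prev, prev⟩

/-- `LockLE l bc`: the lock `l` is nil or not more recent than the certificate `bc`. This is the
condition under which a replica locked on `l` votes for a proposal that carries `bc`. -/
def LockLE (l bc : Option (BlockCert R Id)) : Prop :=
  l = none ∨ ∃ c₀ c, l = some c₀ ∧ bc = some c ∧ c₀.epoch ≤ c.epoch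

theorem LockLE.refl (l : Option (BlockCert R Id)) : LockLE l l := by
  rcases l with _ | c
  exacts [.inl rfl, .inr ⟨c, c, rfl, rfl, le_rfl⟩]

namespace Protocol

variable {P : Protocol R Payload Id} {p q : R} {now t x : ℝ} {ev : Event R Payload Id}
  {s s' : LocalState R Payload Id} {e : ℕ} {d d' : Id} {τ : Timer Id} {m : Msg R Payload Id}
  {b : Block Payload Id} {c : BlockCert R Id} {bc : Option (BlockCert R Id)}

/-! ### Steps of a replica -/

/-- The step of the honest replica `p` in the event `ev` at time `now`. The expiration of a timer is
split according to its effect; `expire` covers the timers that have none. -/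
inductive LocalStep (P : Protocol R Payload Id) (p : R) (now : ℝ) (s : LocalState R Payload Id) :
    Event R Payload Id → LocalState R Payload Id → Prop
  | idle (ev : Event R Payload Id) : LocalStep P p now s ev s
  | bootstrap (h : s.started = false) :
      LocalStep P p now s (.bootstrap p) (P.startEpoch p now 0 s)
  | receive (m : Msg R Payload Id) : LocalStep P p now s (.receive p m) (s.receive m)
  | react (s' : LocalState R Payload Id) (h : P.Reaction p now s s') :
      LocalStep P p now s (.react p) s'
  | expire (τ : Timer Id) (hτ : (τ, now) ∈ s.timers)
      (hnil : ∀ e, τ = .commit e none → s.epoch ≠ e) :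
      LocalStep P p now s (.timeout p τ) { s with timers := s.timers \ {(τ, now)} }
  | epochChange (hτ : (.epochChange s.epoch, now) ∈ s.timers) :
      LocalStep P p now s (.timeout p (.epochChange s.epoch))
        (P.propose p now { s with timers := s.timers \ {(.epochChange s.epoch, now)} })
  | certificate (hτ : (.certificate s.epoch, now) ∈ s.timers)
      (hact : s.status s.epoch = some .active) :
      LocalStep P p now s (.timeout p (.certificate s.epoch))
        (LocalState.broadcast { s with timers := s.timers \ {(.certificate s.epoch, now)} } now
          (.silence s.epoch p))
  | commit (e : ℕ) (h : Id) (hτ : (.commit e (some h), now) ∈ s.timers)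
      (hact : s.status e = some .active) :
      LocalStep P p now s (.timeout p (.commit e (some h)))
        (decideEpoch e h { s with timers := s.timers \ {(.commit e (some h), now)} })
  | commitNil (hτ : (.commit s.epoch none, now) ∈ s.timers) :
      LocalStep P p now s (.timeout p (.commit s.epoch none))
        (P.startEpoch p now (s.epoch + 1)
          { s with timers := s.timers \ {(.commit s.epoch none, now)} })

theorem localStep_timeoutStep (hτ : (τ, now) ∈ s.timers) :
    P.LocalStep p now s (.timeout p τ) (P.timeoutStep p now τ s) := by
  rcases τ with e | e | ⟨e, _ | h⟩ <;> unfold timeoutStep onTimeout <;> dsimp only <;>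
    split_ifs with hif
  · subst hif; exact .epochChange hτ
  · exact .expire _ hτ (by simp)
  · obtain ⟨rfl, hact⟩ := hif; exact .certificate hτ hact
  · exact .expire _ hτ (by simp)
  · subst hif; exact .commitNil hτ
  · exact .expire _ hτ (by simpa using hif)
  · exact .commit e h hτ hif
  · exact .expire _ hτ (by simp)

/-- The block that `p` proposes in epoch `e` when its most recent block certificate is `bc`; it is
`getBlock` as a function of the two fields of the state that matter. -/
def newBlock (P : Protocol R Payload Id) (p : R) (e : ℕ) (bc : Option (BlockCert R Id)) :
    Block Payload Id where
  payload := P.getPayload p e (bc.map BlockCert.id)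
  prev := bc.map BlockCert.id

/-- The condition under which `p`, with most recent block certificate `bc`, proposes as soon as it
starts epoch `e`. -/
def ProposesAtOnce (P : Protocol R Payload Id) (p : R) (e : ℕ) (bc : Option (BlockCert R Id)) :
    Prop :=
  P.leader e = p ∧ (e = 0 ∨ ∃ c ∈ bc, c.epoch + 1 = e)

section Operations

variable (P : Protocol R Payload Id) (p : R) (now : ℝ) (e : ℕ) (s : LocalState R Payload Id)
  (c : BlockCert R Id) (m : Msg R Payload Id) (t x : ℝ) (τ : Timer Id)

attribute [local simp] LocalState.broadcast LocalState.startTimer Protocol.propose enterEpoch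
  ProposesAtOnce

@[grind =]
theorem propose_eq : P.propose p now s = { s with
    hasVoted := true
    outbox := insert (.vote s.epoch (P.id (P.newBlock p s.epoch s.lockedBC)) p, now)
      (insert (.propose s.epoch (P.newBlock p s.epoch s.lockedBC) s.lockedBC, now) s.outbox) } :=
  rfl

@[simp, grind =]
theorem started_startEpoch : (P.startEpoch p now e s).started = true := by
  simp only [startEpoch]; split_ifs <;> rfl

@[simp, grind =]
theorem epoch_startEpoch : (P.startEpoch p now e s).epoch = e := by
  simp only [startEpoch]; split_ifs <;> rfl

@[simp, grind =]
theorem hasVoted_startEpoch :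
    (P.startEpoch p now e s).hasVoted = true ↔ P.ProposesAtOnce p e s.lockedBC := by
  simp only [startEpoch]; split_ifs <;> simp_all

@[simp, grind =]
theorem lockedBC_startEpoch : (P.startEpoch p now e s).lockedBC = s.lockedBC := by
  simp only [startEpoch]; split_ifs <;> rfl

@[simp, grind =]
theorem status_startEpoch (e' : ℕ) : (P.startEpoch p now e s).status e' =
    if e' = e then some .active else s.status e' := by
  simp only [startEpoch]; split_ifs <;> simp_all

@[simp, grind =]
theorem decision_startEpoch (e' : ℕ) : (P.startEpoch p now e s).decision e' =
    if e' = e then none else s.decision e' := by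
  simp only [startEpoch]; split_ifs <;> simp_all

@[simp, grind =]
theorem committed_startEpoch : (P.startEpoch p now e s).committed = s.committed := by
  simp only [startEpoch]; split_ifs <;> rfl

@[simp, grind =]
theorem received_startEpoch : (P.startEpoch p now e s).received = s.received := by
  simp only [startEpoch]; split_ifs <;> rfl

@[simp, grind =]
theorem mem_timers_startEpoch : (τ, x) ∈ (P.startEpoch p now e s).timers ↔
    (τ, x) ∈ s.timers ∨ (τ = .certificate e ∧ x = now + P.timeoutCertificate) ∨
      (P.leader e = p ∧ ¬ P.ProposesAtOnce p e s.lockedBC ∧ τ = .epochChange e ∧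
        x = now + P.timeoutEpochChange) := by
  simp only [startEpoch]; split_ifs <;> simp_all <;> tauto

@[simp, grind =]
theorem mem_outbox_startEpoch : (m, t) ∈ (P.startEpoch p now e s).outbox ↔
    (m, t) ∈ s.outbox ∨ (t = now ∧ P.ProposesAtOnce p e s.lockedBC ∧
      (m = .propose e (P.newBlock p e s.lockedBC) s.lockedBC ∨
        m = .vote e (P.id (P.newBlock p e s.lockedBC)) p)) := by
  simp only [startEpoch]; split_ifs <;> simp_all [getBlock, newBlock]; tauto

@[grind =]
theorem lockAndAdvance_def : P.lockAndAdvance p now c s = P.startEpoch p now (s.epoch + 1)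
    { s with
      lockedBC := some c
      timers := s.timers ∪
        {y | y = (.commit s.epoch (some c.id), now + P.timeoutCommit) ∧
          s.status s.epoch = some .active}
      outbox := insert (.quitEpoch (.block c), now) s.outbox } := by
  simp only [lockAndAdvance]
  split_ifs with hact <;> simp [hact]

@[grind =]
theorem decideEpoch_def (h : Id) : decideEpoch e h s = { s with
    status := fun e' => if e' = e then some .committed else s.status e'
    decision := fun e' => if e' = e then some h else s.decision e' } := by
  simp [decideEpoch, funext_iff, Function.update_apply]

@[grind =]
theorem misbehaviorDetected_def (c : Cert R Id) : misbehaviorDetected P now c s = { s with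
    status := fun e => if e = c.epoch then some .notCommitted else s.status e
    timers := s.timers ∪
      {y | y = (.commit c.epoch none, now + P.timeoutCommit) ∧ c.epoch = s.epoch}
    outbox := s.outbox ∪ {y | y = (.quitEpoch c, now) ∧ c.epoch = s.epoch} } := by
  simp only [misbehaviorDetected]
  split_ifs with hepoch <;> simp [hepoch, funext_iff, Function.update_apply]

end Operations

theorem finite_outbox_startEpoch (hs : s.outbox.Finite) :
    (P.startEpoch p now e s).outbox.Finite := by
  refine ((hs.insert (.propose e (P.newBlock p e s.lockedBC) s.lockedBC, now)).insert
    (.vote e (P.id (P.newBlock p e s.lockedBC)) p, now)).subset ?_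
  rintro ⟨m, t⟩ hm
  grind

theorem HasBlockCert.mono (h : P.HasBlockCert s c) (hs : s.received ⊆ s'.received) :
    P.HasBlockCert s' c :=
  ⟨h.1, h.2.imp (fun hc => hs hc) fun hv q hq => hs (hv q hq)⟩

theorem HasMisbehaviorCert.mono {c : Cert R Id} (h : P.HasMisbehaviorCert s c)
    (hs : s.received ⊆ s'.received) : P.HasMisbehaviorCert s' c := by
  cases c with
  | block c => exact h
  | silence e S => exact ⟨h.1, h.2.imp (fun hc => hs hc) fun hm q hq => hs (hm q hq)⟩
  | equiv e d d' => exact ⟨h.1, h.2.imp (fun hc => hs hc) fun hv => ⟨hs hv.1, hs hv.2⟩⟩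

theorem HasBlockCert.of_quitEpoch (h : P.HasBlockCert s c)
    (hs : .quitEpoch (.block c) ∈ s'.received) : P.HasBlockCert s' c :=
  ⟨h.1, .inl hs⟩

theorem HasMisbehaviorCert.of_quitEpoch {c : Cert R Id} (h : P.HasMisbehaviorCert s c)
    (hs : .quitEpoch c ∈ s'.received) : P.HasMisbehaviorCert s' c := by
  cases c with
  | block c => exact h
  | silence e S => exact ⟨h.1, .inl hs⟩
  | equiv e d d' => exact ⟨h.1, .inl hs⟩

attribute [local grind =] LocalState.broadcast LocalState.receive castVote Protocol.commitBlock
  LocalState.init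
attribute [local grind] LocalState.Reached ProposesAtOnce

namespace LocalStep

theorem started (h : P.LocalStep p now s ev s') (hs : s.started = true) : s'.started = true := by
  cases h with
  | react _ h => cases h <;> grind
  | _ => grind

theorem epoch_le (h : P.LocalStep p now s ev s') (hs : s.started = true) : s.epoch ≤ s'.epoch := by
  cases h with
  | react _ h => cases h <;> grind
  | _ => grind

theorem reached (h : P.LocalStep p now s ev s') (hs : s.Reached e) : s'.Reached e :=
  ⟨h.started hs.1, hs.2.trans (h.epoch_le hs.1)⟩

theorem received_subset (h : P.LocalStep p now s ev s') : s.received ⊆ s'.received := by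
  intro m hm
  cases h with
  | react _ h => cases h <;> grind
  | _ => grind

theorem outbox_subset (h : P.LocalStep p now s ev s') : s.outbox ⊆ s'.outbox := by
  rintro ⟨m, t⟩ hm
  cases h with
  | react _ h => cases h <;> grind
  | _ => grind

theorem committed_subset (h : P.LocalStep p now s ev s') : s.committed ⊆ s'.committed := by
  intro b hb
  cases h with
  | react _ h => cases h <;> grind
  | _ => grind

theorem timer_mem_or_fires (h : P.LocalStep p now s ev s') (hτ : (τ, x) ∈ s.timers) :
    (τ, x) ∈ s'.timers ∨ (x = now ∧ ev = .timeout p τ) := by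
  cases h with
  | react _ h => cases h <;> grind
  | _ => grind

theorem mem_received (h : P.LocalStep p now s ev s') (hm : m ∈ s'.received) :
    m ∈ s.received ∨ ev = .receive p m := by
  cases h with
  | react _ h => cases h <;> grind
  | _ => grind

theorem outbox_time (h : P.LocalStep p now s ev s') (hm : (m, t) ∈ s'.outbox) :
    (m, t) ∈ s.outbox ∨ t = now := by
  cases h with
  | react _ h => cases h <;> grind
  | _ => grind

theorem lockedBC_eq (h : P.LocalStep p now s ev s') (he : s'.epoch = s.epoch)
    (hp : P.leader s.epoch ≠ p) : s'.lockedBC = s.lockedBC := by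
  cases h with
  | react _ h => cases h <;> grind
  | _ => grind

theorem lockedBC_eq_or_recent (h : P.LocalStep p now s ev s') : s'.lockedBC = s.lockedBC ∨
    ∃ c, s'.lockedBC = some c ∧
      (c.epoch = s.epoch ∨ ∀ c₀ ∈ s.lockedBC, c₀.epoch < c.epoch) := by
  cases h with
  | react _ h => cases h <;> grind
  | _ => grind

theorem mem_outbox_silence (h : P.LocalStep p now s ev s') (hm : (.silence e q, t) ∈ s'.outbox) :
    (.silence e q, t) ∈ s.outbox ∨ (q = p ∧ ev = .timeout p (.certificate e) ∧
      (.certificate e, now) ∈ s.timers ∧ s.epoch = e) := by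
  cases h with
  | react _ h => cases h <;> grind
  | _ => grind

theorem mem_committed (h : P.LocalStep p now s ev s') (hb : b ∈ s'.committed) :
    b ∈ s.committed ∨ ∃ e b', s.decision e = some (P.id b') ∧ P.Extends b' b := by
  cases h with
  | react _ h => cases h <;> grind
  | _ => grind

theorem decision_eq (h : P.LocalStep p now s ev s') (hs : s.Reached e)
    (hact : s.status e = some .committed) (hd : s.decision e = some d) :
    s'.status e = some .committed ∧ s'.decision e = some d := by
  cases h with
  | react _ h => cases h <;> grind
  | _ => grind

theorem mem_timers_certificate (h : P.LocalStep p now s ev s')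
    (hτ : (.certificate e, x) ∈ s'.timers) : (.certificate e, x) ∈ s.timers ∨
      (x = now + P.timeoutCertificate ∧ ¬ s.Reached e ∧ s'.Reached e) := by
  cases h with
  | react _ h => cases h <;> grind
  | _ => grind

theorem mem_timers_epochChange (h : P.LocalStep p now s ev s')
    (hτ : (.epochChange e, x) ∈ s'.timers) : (.epochChange e, x) ∈ s.timers ∨
      (x = now + P.timeoutEpochChange ∧ P.leader e = p ∧ ¬ s.Reached e ∧ s'.started = true ∧
        s'.epoch = e ∧ s'.hasVoted = false) := by
  cases h with
  | react _ h => cases h <;> grind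
  | _ => grind

theorem mem_timers_commitNil (h : P.LocalStep p now s ev s')
    (hτ : (.commit e none, x) ∈ s'.timers) : (.commit e none, x) ∈ s.timers ∨
      (x = now + P.timeoutCommit ∧ s.started = true ∧ s.epoch = e ∧
        ∃ c, c.epoch = e ∧ P.HasMisbehaviorCert s c ∧ (.quitEpoch c, now) ∈ s'.outbox) := by
  cases h with
  | react _ h => cases h <;> grind
  | _ => grind

theorem mem_timers_commit (h : P.LocalStep p now s ev s')
    (hτ : (.commit e (some d), x) ∈ s'.timers) : (.commit e (some d), x) ∈ s.timers ∨
      ∃ c, c.epoch = e ∧ c.id = d ∧ P.HasBlockCert s c := by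
  cases h with
  | react _ h => cases h <;> grind
  | _ => grind

theorem mem_outbox_vote (h : P.LocalStep p now s ev s') (hv : (.vote e d q, t) ∈ s'.outbox) :
    (.vote e d q, t) ∈ s.outbox ∨ (t = now ∧ s'.epoch = e ∧ s'.hasVoted = true) := by
  cases h with
  | react _ h => cases h <;> grind
  | _ => grind

theorem hasVoted_of_epoch_eq (h : P.LocalStep p now s ev s') (hs : s.started = true)
    (he : s'.epoch = s.epoch) (hv : s.hasVoted = true) : s'.hasVoted = true := by
  cases h with
  | react _ h => cases h <;> grind
  | _ => grind

theorem vote_unique (h : P.LocalStep p now s ev s') {t' : ℝ}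
    (hold : (.vote e d p, t) ∉ s.outbox) (hnew : (.vote e d p, t) ∈ s'.outbox)
    (hold' : (.vote e d' p, t') ∉ s.outbox) (hnew' : (.vote e d' p, t') ∈ s'.outbox) :
    d = d' := by
  cases h with
  | react _ h => cases h <;> grind
  | _ => grind

theorem finite_outbox (h : P.LocalStep p now s ev s') (hs : s.outbox.Finite) :
    s'.outbox.Finite := by
  cases h with
  | idle | receive | expire => exact hs
  | bootstrap | commitNil => exact finite_outbox_startEpoch hs
  | epochChange => rw [propose_eq]; exact (hs.insert _).insert _
  | certificate => exact hs.insert _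
  | commit => exact hs
  | react _ h =>
    cases h with
    | vote => exact ((hs.insert _).insert _).insert _
    | blockCert => rw [lockAndAdvance_def]; exact finite_outbox_startEpoch (hs.insert _)
    | blockCertLeader => exact hs.insert _
    | fastCommit | commitBlock => exact hs
    | misbehavior c =>
      rw [misbehaviorDetected_def]
      exact hs.union ((Set.finite_singleton _).subset fun _ h => h.1)

end LocalStep

/-! ### Reachable states -/

/-- The states that a replica `p` can reach by steps of the protocol. -/
inductive Reachable (P : Protocol R Payload Id) (p : R) : LocalState R Payload Id → Prop
  | init : Reachable P p .init
  | step {now : ℝ} {ev : Event R Payload Id} {s s' : LocalState R Payload Id}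
      (hs : Reachable P p s) (h : P.LocalStep p now s ev s') : Reachable P p s'

namespace Reachable

theorem eq_of_not_started (hr : P.Reachable p s) (hs : s.started = false) :
    s = { LocalState.init with received := s.received } := by
  induction hr with
  | init => rfl
  | step _ h ih =>
    have := h.started
    cases h with
    | react _ h => cases h <;> grind
    | _ => grind

theorem started_of_timer (hr : P.Reachable p s) (hτ : (τ, x) ∈ s.timers) : s.started = true := by
  by_contra hs
  rw [hr.eq_of_not_started (by simpa using hs)] at hτ
  exact hτ

theorem started_of_mem_outbox (hr : P.Reachable p s) (hm : (m, t) ∈ s.outbox) :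
    s.started = true := by
  by_contra hs
  rw [hr.eq_of_not_started (by simpa using hs)] at hm
  exact hm

theorem status_eq_none_iff (hr : P.Reachable p s) (hs : s.started = true) :
    s.status e = none ↔ s.epoch < e := by
  induction hr with
  | init => cases hs
  | step hr h ih =>
    have := hr.eq_of_not_started
    cases h with
    | react _ h => cases h <;> grind
    | _ => grind [hr.started_of_timer]

theorem exists_misbehaviorCert (hr : P.Reachable p s) (hnot : s.status e = some .notCommitted) :
    ∃ c, c.epoch = e ∧ P.HasMisbehaviorCert s c := by
  induction hr with
  | init => cases hnot
  | @step now ev s s' _ h ih =>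
    suffices hcert : s.status e = some .notCommitted ∨
        ∃ c, c.epoch = e ∧ P.HasMisbehaviorCert s c by
      obtain ⟨c, hc, hcert⟩ := hcert.elim ih _root_.id
      exact ⟨c, hc, hcert.mono h.received_subset⟩
    cases h with
    | react _ h => cases h <;> grind
    | _ => grind

theorem exists_timer_of_notCommitted (hr : P.Reachable p s) (hs : s.started = true)
    (hnot : s.status s.epoch = some .notCommitted) : ∃ x, (.commit s.epoch none, x) ∈ s.timers := by
  induction hr with
  | init => cases hs
  | @step now ev s s' hr h ih =>
    have := hr.eq_of_not_started
    have := @hr.status_eq_none_iff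
    by_cases hold : s.started = true ∧ s.epoch = s'.epoch ∧ s.status s.epoch = some .notCommitted
    · obtain ⟨hs, he, hnot⟩ := hold
      obtain ⟨x, hτ⟩ := ih hs hnot
      rcases h.timer_mem_or_fires hτ with hτ | ⟨-, rfl⟩
      · exact ⟨x, he ▸ hτ⟩
      · cases h <;> grind
    · refine ⟨now + P.timeoutCommit, ?_⟩
      cases h with
      | react _ h => cases h <;> grind
      | _ => grind [hr.started_of_timer]

theorem exists_blockCert_of_timer (hr : P.Reachable p s) (hτ : (.commit e (some d), x) ∈ s.timers) :
    ∃ c, c.epoch = e ∧ c.id = d ∧ P.HasBlockCert s c := by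
  induction hr with
  | init => cases hτ
  | step _ h ih =>
    obtain ⟨c, hc, hd, hcert⟩ := (h.mem_timers_commit hτ).elim ih _root_.id
    exact ⟨c, hc, hd, hcert.mono h.received_subset⟩

theorem exists_blockCert [Fintype R] (hr : P.Reachable p s) (hcard : P.f + 1 ≤ Fintype.card R)
    (hd : s.decision e = some d) : ∃ c, c.epoch = e ∧ c.id = d ∧ P.HasBlockCert s c := by
  induction hr with
  | init => cases hd
  | @step now ev s s' hr h ih =>
    have hfast (hvotes : ∀ q : R, .vote e d q ∈ s.received) :
        ∃ c, c.epoch = e ∧ c.id = d ∧ P.HasBlockCert s c :=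
      ⟨⟨e, d, Finset.univ⟩, rfl, rfl, hcard, .inr fun q _ => hvotes q⟩
    suffices hcert : s.decision e = some d ∨ ∃ c, c.epoch = e ∧ c.id = d ∧ P.HasBlockCert s c by
      obtain ⟨c, hc, hd, hcert⟩ := hcert.elim ih _root_.id
      exact ⟨c, hc, hd, hcert.mono h.received_subset⟩
    cases h with
    | commit e' d' hτ hact => have := hr.exists_blockCert_of_timer hτ; grind
    | react _ h => cases h <;> grind
    | _ => grind

theorem decision_ne_none (hr : P.Reachable p s) (hcom : s.status e = some .committed) :
    s.decision e ≠ none := by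
  induction hr with
  | init => cases hcom
  | step _ h ih =>
    cases h with
    | react _ h => cases h <;> grind
    | _ => grind

theorem hasBlockCert_lockedBC (hr : P.Reachable p s) (hc : s.lockedBC = some c) :
    P.HasBlockCert s c := by
  induction hr with
  | init => cases hc
  | @step now ev s s' _ h ih =>
    suffices hcert : s.lockedBC = some c ∨ P.HasBlockCert s c from
      (hcert.elim ih _root_.id).mono h.received_subset
    cases h with
    | react _ h => cases h <;> grind
    | _ => grind

theorem exists_quitEpoch_lockedBC (hr : P.Reachable p s) (hc : s.lockedBC = some c) :
    ∃ t, (.quitEpoch (.block c), t) ∈ s.outbox := by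
  induction hr with
  | init => cases hc
  | step _ h ih =>
    cases h with
    | react _ h => cases h <;> grind
    | _ => grind

theorem reached_of_vote (hr : P.Reachable p s) (hv : (.vote e d q, t) ∈ s.outbox) :
    s.Reached e := by
  induction hr with
  | init => cases hv
  | step hr h ih =>
    rcases h.mem_outbox_vote hv with hold | ⟨-, he, -⟩
    · exact h.reached (ih hold)
    · exact ⟨(hr.step h).started_of_mem_outbox hv, he.ge⟩

theorem hasVoted_of_vote (hr : P.Reachable p s) (hv : (.vote s.epoch d q, t) ∈ s.outbox) :
    s.hasVoted = true := by
  induction hr with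
  | init => cases hv
  | @step now ev s s' hr h ih =>
    rcases h.mem_outbox_vote hv with hold | ⟨-, -, hvoted⟩
    · obtain ⟨hs, hle⟩ := hr.reached_of_vote hold
      have he : s'.epoch = s.epoch := hle.antisymm (h.epoch_le hs)
      exact h.hasVoted_of_epoch_eq hs he (ih (he ▸ hold))
    · exact hvoted

theorem exists_vote (hr : P.Reachable p s) (hv : s.hasVoted = true) :
    ∃ d t, (.vote s.epoch d p, t) ∈ s.outbox := by
  induction hr with
  | init => cases hv
  | @step now ev s s' _ h ih =>
    by_cases hold : s.hasVoted = true ∧ s.epoch = s'.epoch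
    · obtain ⟨d, t, hd⟩ := ih hold.1
      exact ⟨d, t, hold.2 ▸ h.outbox_subset hd⟩
    · obtain ⟨b, bc, rfl⟩ | hown : (∃ b bc, s' = P.castVote p now b bc s) ∨
          (.vote s'.epoch (P.id (P.newBlock p s'.epoch s'.lockedBC)) p, now) ∈ s'.outbox := by
        cases h with
        | react _ h => cases h <;> grind
        | _ => grind
      · exact ⟨P.id b, now, by grind⟩
      · exact ⟨_, now, hown⟩

theorem vote_of_propose (hr : P.Reachable p s) (hm : (.propose e b bc, t) ∈ s.outbox) :
    (.vote e (P.id b) p, t) ∈ s.outbox := by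
  induction hr with
  | init => cases hm
  | step _ h ih =>
    cases h with
    | react _ h => cases h <;> grind
    | _ => grind

theorem leader_of_timer (hr : P.Reachable p s) (hτ : (.epochChange e, x) ∈ s.timers) :
    P.leader e = p := by
  induction hr with
  | init => cases hτ
  | step _ h ih => exact (h.mem_timers_epochChange hτ).elim ih fun hnew => hnew.2.1

theorem reached_of_timer (hr : P.Reachable p s) (hτ : (.epochChange e, x) ∈ s.timers) :
    s.Reached e := by
  induction hr with
  | init => cases hτ
  | step _ h ih =>
    rcases h.mem_timers_epochChange hτ with hold | ⟨-, -, -, hs, he, -⟩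
    · exact h.reached (ih hold)
    · exact ⟨hs, he.ge⟩

theorem timer_unique {x' : ℝ} (hr : P.Reachable p s) (hτ : (.epochChange e, x) ∈ s.timers)
    (hτ' : (.epochChange e, x') ∈ s.timers) : x = x' := by
  induction hr with
  | init => cases hτ
  | step hr h ih =>
    rcases h.mem_timers_epochChange hτ with hold | ⟨hx, -, hnew, -⟩ <;>
      rcases h.mem_timers_epochChange hτ' with hold' | ⟨hx', -, hnew', -⟩
    · exact ih hold hold'
    · exact absurd (hr.reached_of_timer hold) hnew'
    · exact absurd (hr.reached_of_timer hold') hnew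
    · exact hx.trans hx'.symm

theorem status_eq_or_exists_blockCert [Fintype R] (hr : P.Reachable p s)
    (hcard : P.f + 1 ≤ Fintype.card R) (hs : s.Reached e) :
    s.status e = some .active ∨ s.status e = some .notCommitted ∨
      ∃ c, c.epoch = e ∧ P.HasBlockCert s c := by
  rcases hstatus : s.status e with _ | _ | _ | _
  · exact absurd ((hr.status_eq_none_iff hs.1).1 hstatus) hs.2.not_gt
  · exact .inl rfl
  · obtain ⟨d, hd⟩ := Option.ne_none_iff_exists'.1 (hr.decision_ne_none hstatus)
    obtain ⟨c, hc, -, hcert⟩ := hr.exists_blockCert hcard hd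
    exact .inr (.inr ⟨c, hc, hcert⟩)
  · exact .inr (.inl rfl)

end Reachable

/-! ### Starting an epoch and voting -/

/-- The three ways in which a replica `p` starts an epoch at time `now`. -/
inductive EpochStart (P : Protocol R Payload Id) (p : R) (now : ℝ) (s : LocalState R Payload Id) :
    ℕ → LocalState R Payload Id → Prop
  | bootstrap (hs : s.started = false) : EpochStart P p now s 0 (P.startEpoch p now 0 s)
  | blockCert (c : BlockCert R Id) (hs : s.started = true) (hcert : P.HasBlockCert s c)
      (hc : c.epoch = s.epoch) :
      EpochStart P p now s (s.epoch + 1) (P.lockAndAdvance p now c s)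
  | commitNil (hτ : (.commit s.epoch none, now) ∈ s.timers) :
      EpochStart P p now s (s.epoch + 1) (P.startEpoch p now (s.epoch + 1)
        { s with timers := s.timers \ {(.commit s.epoch none, now)} })

namespace EpochStart

theorem epoch_eq (h : P.EpochStart p now s e s') : s'.epoch = e := by
  cases h <;> grind

theorem mem_timers_certificate (h : P.EpochStart p now s e s') :
    (.certificate e, now + P.timeoutCertificate) ∈ s'.timers := by
  cases h <;> grind

theorem exists_propose_or_mem_timers (h : P.EpochStart p now s e s') (hp : P.leader e = p) :
    (∃ b bc, (.propose e b bc, now) ∈ s'.outbox) ∨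
      (.epochChange e, now + P.timeoutEpochChange) ∈ s'.timers := by
  by_cases hprop : (.propose e (P.newBlock p e s'.lockedBC) s'.lockedBC, now) ∈ s'.outbox
  · exact .inl ⟨_, _, hprop⟩
  · right
    cases h <;> grind

theorem exists_blockCert_or_timer (h : P.EpochStart p now s (e + 1) s') (hr : P.Reachable p s) :
    s.Reached e ∧ ((∃ c, c.epoch = e ∧ P.HasBlockCert s c ∧
        (.quitEpoch (.block c), now) ∈ s'.outbox ∧ s'.lockedBC = some c ∧
        (s.status e = some .active →
          (.commit e (some c.id), now + P.timeoutCommit) ∈ s'.timers)) ∨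
      (.commit e none, now) ∈ s.timers) := by
  cases h with
  | blockCert c hs hcert hc =>
    refine ⟨⟨hs, le_rfl⟩, .inl ⟨c, hc, hcert, ?_, ?_, ?_⟩⟩ <;> grind
  | commitNil hτ => exact ⟨⟨hr.started_of_timer hτ, le_rfl⟩, .inr hτ⟩

end EpochStart

theorem LocalStep.epochStart (h : P.LocalStep p now s ev s') (hr : P.Reachable p s)
    (hold : ¬ s.Reached e) (hnew : s'.Reached e) : P.EpochStart p now s e s' := by
  have hlt (hs : s.started = true) : s.epoch < e := not_le.1 fun hle => hold ⟨hs, hle⟩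
  obtain ⟨hs', hle⟩ := hnew
  cases h with
  | bootstrap hs =>
    obtain rfl : e = 0 := by simpa using hle
    exact .bootstrap hs
  | commitNil hτ =>
    obtain rfl : e = s.epoch + 1 := by grind [hr.started_of_timer]
    exact .commitNil hτ
  | react _ h =>
    cases h with
    | blockCert c hs hcert hc =>
      obtain rfl : e = s.epoch + 1 := by grind
      exact .blockCert c hs hcert hc
    | _ => grind
  | _ => grind [hr.started_of_timer]

/-- How a replica `p` comes to sign, in an event `ev` at time `now`, a vote of epoch `e` for the
block `b` that is proposed with the certificate `bc`: it accepts a proposal it has received, or it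
is the leader and makes the proposal, on starting the epoch or when its waiting time is over. -/
inductive VoteOrigin (P : Protocol R Payload Id) (p : R) (now : ℝ) (ev : Event R Payload Id)
    (s s' : LocalState R Payload Id) (e : ℕ) (b : Block Payload Id) (bc : Option (BlockCert R Id)) :
    Prop
  | accepted (hs : s.started = true) (he : s.epoch = e) (hnew : s.hasVoted = false)
      (hvalid : P.ValidProposal b bc) (hprop : .propose e b bc ∈ s.received)
      (hvote : .vote e (P.id b) (P.leader e) ∈ s.received)
  | proposedAtOnce (hold : ¬ s.Reached e) (hp : P.ProposesAtOnce p e bc)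
      (hb : b = P.newBlock p e bc) (hcert : ∀ c ∈ bc, P.HasBlockCert s c)
  | proposedLater (hp : P.leader e = p) (hev : ev = .timeout p (.epochChange e))
      (hτ : (.epochChange e, now) ∈ s.timers) (hτ' : (.epochChange e, now) ∉ s'.timers)
      (he : s.epoch = e) (hbc : bc = s.lockedBC)
      (hb : b = P.newBlock p e bc) (hcert : ∀ c ∈ bc, P.HasBlockCert s c)

theorem VoteOrigin.prev_eq (h : P.VoteOrigin p now ev s s' e b bc) :
    b.prev = bc.map BlockCert.id := by
  cases h with
  | accepted _ _ _ hvalid => exact hvalid.2.1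
  | proposedAtOnce _ _ hb => exact hb ▸ rfl
  | proposedLater _ _ _ _ _ _ hb => exact hb ▸ rfl

theorem LocalStep.exists_voteOrigin (h : P.LocalStep p now s ev s') (hr : P.Reachable p s)
    (hold : (.vote e d p, t) ∉ s.outbox) (hnew : (.vote e d p, t) ∈ s'.outbox) :
    ∃ b bc, d = P.id b ∧ (.propose e b bc, t) ∈ s'.outbox ∧ LockLE s'.lockedBC bc ∧
      P.VoteOrigin p now ev s s' e b bc := by
  have hlock : ∀ c ∈ s.lockedBC, P.HasBlockCert s c := fun c hc => hr.hasBlockCert_lockedBC hc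
  cases h with
  | bootstrap hs =>
    refine ⟨P.newBlock p e s.lockedBC, s.lockedBC, ?_, ?_, ?_, .proposedAtOnce ?_ ?_ rfl hlock⟩ <;>
      grind [LockLE.refl]
  | commitNil hτ =>
    refine ⟨P.newBlock p e s.lockedBC, s.lockedBC, ?_, ?_, ?_, .proposedAtOnce ?_ ?_ rfl hlock⟩ <;>
      grind [LockLE.refl]
  | epochChange hτ =>
    refine ⟨P.newBlock p e s.lockedBC, s.lockedBC, ?_, ?_, ?_,
      .proposedLater ?_ ?_ ?_ ?_ ?_ rfl rfl hlock⟩ <;>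
      grind [LockLE.refl, hr.leader_of_timer hτ]
  | react _ h =>
    cases h with
    | vote b bc hs hprop hvote hact hvalid hvoted hcond =>
      refine ⟨b, bc, ?_, ?_, hcond, .accepted hs ?_ hvoted hvalid ?_ ?_⟩ <;> grind
    | blockCert c hs hcert hc =>
      refine ⟨P.newBlock p e (some c), some c, ?_, ?_, ?_, .proposedAtOnce ?_ ?_ rfl ?_⟩ <;>
        grind [LockLE.refl]
    | _ => grind
  | _ => grind

theorem Enabled.of_time (h : P.Enabled p now s) (t : ℝ) : P.Enabled p t s := by
  obtain ⟨_, h⟩ := h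
  cases h with
  | vote b bc hs hprop hvote hact hvalid hnew hcond =>
    exact ⟨_, .vote b bc hs hprop hvote hact hvalid hnew hcond⟩
  | blockCert c hs hcert he => exact ⟨_, .blockCert c hs hcert he⟩
  | blockCertLeader c hs hcert he hp hrecent =>
    exact ⟨_, .blockCertLeader c hs hcert he hp hrecent⟩
  | fastCommit e d hs hvotes hact => exact ⟨_, .fastCommit e d hs hvotes hact⟩
  | commitBlock e b bc hs hprop hd hnew => exact ⟨_, .commitBlock e b bc hs hprop hd hnew⟩
  | misbehavior c hs hcert hact => exact ⟨_, .misbehavior c hs hcert hact⟩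

theorem deadline_of_not_isLarge {GST : ℝ} (hm : ¬ m.IsLarge) (t : ℝ) :
    P.deadline GST m t = t + P.ΔS := by
  simp [deadline, hm]

theorem ProposesAtOnce.lockLE {bc' : Option (BlockCert R Id)} (h : P.ProposesAtOnce p e bc)
    (hbc' : ∀ c ∈ bc', c.epoch < e) : LockLE bc' bc := by
  rcases bc' with _ | c'
  · exact .inl rfl
  have hlt := hbc' c' rfl
  obtain ⟨-, rfl | ⟨c, hc, hce⟩⟩ := h
  · exact absurd hlt (Nat.not_lt_zero _)
  · exact .inr ⟨c', c, rfl, hc, by lia⟩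

end Protocol

namespace Execution

variable {P : Protocol R Payload Id} {honest : Set R} {GST : ℝ} {X : Execution P honest GST}
  {p q : R} {e e' i j k : ℕ} {t t' x T : ℝ} {m : Msg R Payload Id} {d d' : Id}
  {c : BlockCert R Id} {a b b' : Block Payload Id} {bc : Option (BlockCert R Id)} {τ : Timer Id}

/-! ### Executions -/

theorem localStep (X : Execution P honest GST) (hp : p ∈ honest) (i : ℕ) :
    P.LocalStep p (X.time i) (X.state i p) (X.event i) (X.state (i + 1) p) := by
  by_cases hactor : (X.event i).actor = some p
  · cases hev : X.event i with
    | idle => simp [hev, Event.actor] at hactor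
    | bootstrap q =>
      obtain rfl : q = p := by simpa [hev, Event.actor] using hactor
      obtain ⟨hstart, hstate⟩ := X.bootstrap_step i q hp hev
      exact hstate ▸ .bootstrap hstart
    | receive q m =>
      obtain rfl : q = p := by simpa [hev, Event.actor] using hactor
      exact (X.receive_step i q hp m hev).2 ▸ .receive m
    | react q =>
      obtain rfl : q = p := by simpa [hev, Event.actor] using hactor
      exact .react _ (X.react_step i q hp hev)
    | timeout q τ =>
      obtain rfl : q = p := by simpa [hev, Event.actor] using hactor
      obtain ⟨hτ, hstate⟩ := X.timeout_step i q hp τ hev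
      exact hstate ▸ Protocol.localStep_timeoutStep hτ
  · rw [X.frame i p hp hactor]
    exact .idle _

theorem reachable (hp : p ∈ honest) (i : ℕ) : P.Reachable p (X.state i p) := by
  induction i with
  | zero => rw [X.state_zero p hp]; exact .init
  | succ i ih => exact ih.step (X.localStep hp i)

theorem received_mono (hp : p ∈ honest) (hij : i ≤ j) :
    (X.state i p).received ⊆ (X.state j p).received :=
  monotone_nat_of_le_succ (f := fun i => (X.state i p).received)
    (fun i => (X.localStep hp i).received_subset) hij

theorem outbox_mono (hp : p ∈ honest) (hij : i ≤ j) :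
    (X.state i p).outbox ⊆ (X.state j p).outbox :=
  monotone_nat_of_le_succ (f := fun i => (X.state i p).outbox)
    (fun i => (X.localStep hp i).outbox_subset) hij

theorem committed_mono (hp : p ∈ honest) (hij : i ≤ j) :
    (X.state i p).committed ⊆ (X.state j p).committed :=
  monotone_nat_of_le_succ (f := fun i => (X.state i p).committed)
    (fun i => (X.localStep hp i).committed_subset) hij

theorem reached_mono (hp : p ∈ honest) (hij : i ≤ j) (h : (X.state i p).Reached e) :
    (X.state j p).Reached e := by
  induction j, hij using Nat.le_induction with
  | base => exact h
  | succ j _ ih => exact (X.localStep hp j).reached ih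

theorem exists_start (hp : p ∈ honest) (h : (X.state i p).Reached e) :
    ∃ k < i, ¬ (X.state k p).Reached e ∧ (X.state (k + 1) p).Reached e :=
  exists_lt_not_and_succ (Q := fun i => (X.state i p).Reached e)
    (by simp [LocalState.Reached, X.state_zero p hp, LocalState.init]) h

theorem start_unique (hp : p ∈ honest) (hi : ¬ (X.state i p).Reached e)
    (hi' : (X.state (i + 1) p).Reached e) (hj : ¬ (X.state j p).Reached e)
    (hj' : (X.state (j + 1) p).Reached e) : i = j := by
  rcases lt_trichotomy i j with hlt | heq | hlt
  · exact absurd (reached_mono hp hlt hi') hj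
  · exact heq
  · exact absurd (reached_mono hp hlt hj') hi

theorem epochStart (hp : p ∈ honest) (hi : ¬ (X.state i p).Reached e)
    (hi' : (X.state (i + 1) p).Reached e) :
    P.EpochStart p (X.time i) (X.state i p) e (X.state (i + 1) p) :=
  (X.localStep hp i).epochStart (reachable hp i) hi hi'

theorem exists_broadcast (hp : p ∈ honest) (hm : (m, t) ∈ (X.state i p).outbox) :
    ∃ k < i, (m, t) ∉ (X.state k p).outbox ∧ (m, t) ∈ (X.state (k + 1) p).outbox ∧
      t = X.time k := by
  obtain ⟨k, hk, hold, hnew⟩ := exists_lt_not_and_succ (Q := fun i => (m, t) ∈ (X.state i p).outbox)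
    (by simp [X.state_zero p hp, LocalState.init]) hm
  exact ⟨k, hk, hold, hnew, ((X.localStep hp k).outbox_time hnew).resolve_left hold⟩

theorem finite_outbox (hp : p ∈ honest) (i : ℕ) : (X.state i p).outbox.Finite := by
  induction i with
  | zero => simp [X.state_zero p hp, LocalState.init]
  | succ i ih => exact (X.localStep hp i).finite_outbox ih

theorem voteSigned_mono (hij : i ≤ j) (h : VoteSigned honest (X.state i) e d q) :
    VoteSigned honest (X.state j) e d q :=
  fun hq => (h hq).imp fun _ ht => outbox_mono hq hij ht

theorem silenceSigned_mono (hij : i ≤ j) (h : SilenceSigned honest (X.state i) e q) :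
    SilenceSigned honest (X.state j) e q :=
  fun hq => (h hq).imp fun _ ht => outbox_mono hq hij ht

theorem certSigned_mono {c : Cert R Id} (hij : i ≤ j) (h : CertSigned P honest (X.state i) c) :
    CertSigned P honest (X.state j) c := by
  cases c with
  | block c => exact fun q hq => voteSigned_mono hij (h q hq)
  | silence e S => exact fun q hq => silenceSigned_mono hij (h q hq)
  | equiv e d d' => exact h.imp (voteSigned_mono hij) (voteSigned_mono hij)

theorem authentic_mono (hij : i ≤ j) (h : Authentic P honest (X.state i) m) :
    Authentic P honest (X.state j) m := by
  cases m with
  | propose e b bc => exact fun c hc => certSigned_mono hij (h c hc)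
  | vote e d q => exact voteSigned_mono hij h
  | silence e q => exact silenceSigned_mono hij h
  | quitEpoch c => exact certSigned_mono hij h

theorem authentic_of_mem_received (hp : p ∈ honest) (hm : m ∈ (X.state i p).received) :
    Authentic P honest (X.state i) m := by
  induction i with
  | zero => simp [X.state_zero p hp, LocalState.init] at hm
  | succ i ih =>
    exact authentic_mono i.le_succ (((X.localStep hp i).mem_received hm).elim ih
      fun hev => (X.receive_step i p hp m hev).1)

theorem certSigned_of_hasBlockCert (hp : p ∈ honest) (hc : P.HasBlockCert (X.state i p) c) :
    CertSigned P honest (X.state i) (.block c) :=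
  hc.2.elim (authentic_of_mem_received hp) fun hvotes q hq =>
    authentic_of_mem_received hp (hvotes q hq)

theorem certSigned_of_hasMisbehaviorCert {c : Cert R Id} (hp : p ∈ honest)
    (hc : P.HasMisbehaviorCert (X.state i p) c) : CertSigned P honest (X.state i) c := by
  cases c with
  | block c => exact hc.elim
  | silence e S =>
    exact hc.2.elim (authentic_of_mem_received hp) fun hm q hq =>
      authentic_of_mem_received hp (hm q hq)
  | equiv e d d' =>
    exact hc.2.elim (authentic_of_mem_received hp) fun hv =>
      ⟨authentic_of_mem_received hp hv.1, authentic_of_mem_received hp hv.2⟩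

theorem exists_honest_vote [Fintype R] (hM : HonestMajority P honest) (hc : P.WellFormed c)
    (hsigned : CertSigned P honest (X.state i) (.block c)) :
    ∃ q ∈ honest, ∃ t, (.vote c.epoch c.id q, t) ∈ (X.state i q).outbox := by
  obtain ⟨q, hq, hhonest⟩ := hM.exists_mem_honest hc
  exact ⟨q, hhonest, hsigned q hq hhonest⟩

theorem exists_lt_time (X : Execution P honest GST) (T : ℝ) : ∃ i, T < X.time i :=
  (X.time_tendsto.eventually_gt_atTop T).exists

open Classical in
/-- The index of the first event after time `T`, so that `X.state (X.endOf T)` is the state of the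
system at the end of the instant `T`, when no rule is enabled any more. -/
noncomputable def endOf (X : Execution P honest GST) (T : ℝ) : ℕ := Nat.find (X.exists_lt_time T)

theorem lt_time_endOf (X : Execution P honest GST) (T : ℝ) : T < X.time (X.endOf T) := by
  classical exact Nat.find_spec (X.exists_lt_time T)

theorem endOf_le (h : T < X.time i) : X.endOf T ≤ i := by
  classical exact Nat.find_min' (X.exists_lt_time T) h

theorem lt_endOf : i < X.endOf T ↔ X.time i ≤ T :=
  ⟨fun h => not_lt.1 (mt endOf_le h.not_ge), fun h => not_le.1 fun hle =>
    ((X.lt_time_endOf T).trans_le (X.time_mono hle)).not_ge h⟩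

theorem endOf_mono {T' : ℝ} (h : T ≤ T') : X.endOf T ≤ X.endOf T' :=
  endOf_le (h.trans_lt (X.lt_time_endOf T'))

theorem not_enabled_endOf (hp : p ∈ honest) (T t : ℝ) :
    ¬ P.Enabled p t (X.state (X.endOf T) p) := by
  intro h
  cases hend : X.endOf T with
  | zero =>
    obtain ⟨_, h⟩ := h
    rw [hend, X.state_zero p hp] at h
    cases h <;> simp_all [LocalState.init]
  | succ j =>
    have hlt := X.lt_time_endOf T
    have hle : X.time j ≤ T := lt_endOf.1 (by lia)
    rw [hend] at h hlt
    exact (hle.trans_lt hlt).ne' (X.urgent j p hp (h.of_time _))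

theorem mem_received_endOf (hp : p ∈ honest) (hq : q ∈ honest)
    (hm : (m, t) ∈ (X.state i p).outbox) (hT : P.deadline GST m t ≤ T) (hi : i ≤ X.endOf T) :
    m ∈ (X.state (X.endOf T) q).received :=
  X.delivery _ p hp q hq m t (outbox_mono hp hi hm) (hT.trans_lt (X.lt_time_endOf T))

theorem mem_received_endOf_of_not_isLarge (hp : p ∈ honest) (hq : q ∈ honest)
    (hm : (m, t) ∈ (X.state i p).outbox) (hsmall : ¬ m.IsLarge) (hΔS : 0 < P.ΔS) :
    m ∈ (X.state (X.endOf (t + P.ΔS)) q).received := by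
  obtain ⟨k, -, -, hk, rfl⟩ := exists_broadcast hp hm
  exact mem_received_endOf hp hq hk (P.deadline_of_not_isLarge hsmall _).le
    (lt_endOf.2 (by linarith))

theorem exists_timeout (hp : p ∈ honest) (hτ : (τ, x) ∈ (X.state i p).timers) :
    ∃ k, i ≤ k ∧ X.event k = .timeout p τ ∧ X.time k = x := by
  by_contra! hfires
  have hall (j : ℕ) (hj : i ≤ j) : (τ, x) ∈ (X.state j p).timers := by
    induction j, hj using Nat.le_induction with
    | base => exact hτ
    | succ j hj ih =>
      exact ((X.localStep hp j).timer_mem_or_fires ih).resolve_right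
        fun ⟨htime, hev⟩ => hfires j hj hev htime.symm
  obtain ⟨j, hj⟩ := X.exists_lt_time x
  have hdue := X.timer_due _ p hp τ x (hall (max i j) (le_max_left _ _))
  exact (hj.trans_le (X.time_mono (le_max_right i j))).not_ge hdue

/-! ### Synchronisation of epochs -/

theorem exists_bootstrap (X : Execution P honest GST) : ∃ t₀, ∀ p ∈ honest, ∃ i,
    ¬ (X.state i p).Reached 0 ∧ (X.state (i + 1) p).Reached 0 ∧
      t₀ ≤ X.time i ∧ X.time i ≤ t₀ + P.ΔS := by
  obtain ⟨t₀, hstart⟩ := X.start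
  refine ⟨t₀, fun p hp => ?_⟩
  obtain ⟨i, hev, hi⟩ := hstart p hp
  obtain ⟨hs, hstate⟩ := X.bootstrap_step i p hp hev
  exact ⟨i, by simp [LocalState.Reached, hs], by simp [LocalState.Reached, hstate], hi⟩

theorem exists_misbehaviorCert_of_timer (hp : p ∈ honest)
    (hτ : (.commit e none, x) ∈ (X.state i p).timers) :
    ∃ k < i, x = X.time k + P.timeoutCommit ∧ (X.state k p).Reached e ∧ ∃ c, c.epoch = e ∧
      P.HasMisbehaviorCert (X.state k p) c ∧
      (.quitEpoch c, X.time k) ∈ (X.state (k + 1) p).outbox := by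
  obtain ⟨k, hk, hold, hnew⟩ := exists_lt_not_and_succ
    (Q := fun i => (Timer.commit e none, x) ∈ (X.state i p).timers)
    (by simp [X.state_zero p hp, LocalState.init]) hτ
  obtain ⟨hx, hs, he, hcert⟩ := ((X.localStep hp k).mem_timers_commitNil hnew).resolve_left hold
  exact ⟨k, hk, hx, ⟨hs, he.ge⟩, hcert⟩

theorem reached_succ_of_timeout (hp : p ∈ honest) (hev : X.event i = .timeout p (.commit e none))
    (hi : (X.state i p).Reached e) : (X.state (i + 1) p).Reached (e + 1) := by
  rcases hi.succ_or_epoch_eq with hsucc | he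
  · exact (X.localStep hp i).reached hsucc
  · have hstate := (X.timeout_step i p hp _ hev).2
    simp only [Protocol.timeoutStep, Protocol.onTimeout, he, if_true] at hstate
    simp [LocalState.Reached, hstate]

theorem reached_succ_of_blockCert (hp : p ∈ honest)
    (hT : (X.state (X.endOf T) p).Reached e)
    (hcert : P.HasBlockCert (X.state (X.endOf T) p) c) (hc : c.epoch = e) :
    (X.state (X.endOf T) p).Reached (e + 1) :=
  hT.succ_or_epoch_eq.resolve_right fun he =>
    not_enabled_endOf hp T T ⟨_, .blockCert c hT.1 hcert (hc.trans he.symm)⟩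

theorem reached_succ_of_misbehaviorCert [Fintype R] (hcard : P.f + 1 ≤ Fintype.card R)
    (hΔS : 0 ≤ P.ΔS) {c : Cert R Id} (hp : p ∈ honest)
    (hT : (X.state (X.endOf T) p).Reached e)
    (hcert : P.HasMisbehaviorCert (X.state (X.endOf T) p) c) (hc : c.epoch = e) :
    (X.state (X.endOf (T + P.timeoutCommit)) p).Reached (e + 1) := by
  have hle : T ≤ T + P.timeoutCommit := by unfold Protocol.timeoutCommit; linarith
  rcases hT.succ_or_epoch_eq with hsucc | he
  · exact reached_mono hp (endOf_mono hle) hsucc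
  rcases (reachable hp _).status_eq_or_exists_blockCert hcard hT with
    hact | hnot | ⟨c', hc', hcert'⟩
  · exact absurd ⟨_, .misbehavior c hT.1 hcert (hc ▸ hact)⟩ (not_enabled_endOf hp T T)
  · obtain ⟨x, hτ⟩ := (reachable hp _).exists_timer_of_notCommitted hT.1 (he ▸ hnot)
    rw [he] at hτ
    obtain ⟨k, hk, rfl, -⟩ := exists_misbehaviorCert_of_timer hp hτ
    obtain ⟨m, hm, hev, htime⟩ := exists_timeout hp hτ
    refine reached_mono hp ?_ (reached_succ_of_timeout hp hev (reached_mono hp hm hT))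
    exact lt_endOf.2 (htime.trans_le (by linarith [lt_endOf.1 hk]))
  · exact reached_mono hp (endOf_mono hle) (reached_succ_of_blockCert hp hT hcert' hc')

theorem reached_sync [Fintype R] (hcard : P.f + 1 ≤ Fintype.card R) (hΔS : 0 < P.ΔS)
    (hp : p ∈ honest) (hq : q ∈ honest) (hi : (X.state (i + 1) p).Reached e) :
    (X.state (X.endOf (X.time i + P.ΔS)) q).Reached e := by
  obtain ⟨k, hk, hold, hnew⟩ := exists_start hp hi
  have hki : X.time k ≤ X.time i := X.time_mono (Nat.lt_succ_iff.1 hk)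
  suffices hsync : (X.state (X.endOf (X.time k + P.ΔS)) q).Reached e from
    reached_mono hq (endOf_mono (by linarith)) hsync
  clear hi hk hki
  induction e generalizing k with
  | zero =>
    obtain ⟨t₀, hboot⟩ := X.exists_bootstrap
    obtain ⟨kp, holdp, hnewp, hkp, -⟩ := hboot p hp
    obtain ⟨kq, -, hnewq, -, hkq⟩ := hboot q hq
    obtain rfl := start_unique hp hold hnew holdp hnewp
    exact reached_mono hq (lt_endOf.2 (by linarith)) hnewq
  | succ e ih =>
    have hsync {l : ℕ} (hl : (X.state l p).Reached e) :
        (X.state (X.endOf (X.time l + P.ΔS)) q).Reached e := by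
      obtain ⟨l', hl', hold', hnew'⟩ := exists_start hp hl
      refine reached_mono hq (endOf_mono ?_) (ih l' hold' hnew')
      linarith [X.time_mono hl'.le]
    obtain ⟨hreach, ⟨c, hc, hcert, hquit, -⟩ | hτ⟩ :=
      (epochStart hp hold hnew).exists_blockCert_or_timer (reachable hp k)
    · have hrec := mem_received_endOf_of_not_isLarge hp hq hquit (by simp [Msg.IsLarge]) hΔS
      exact reached_succ_of_blockCert hq (hsync hreach) (hcert.of_quitEpoch hrec) hc
    · obtain ⟨l, -, htime, hl, c, hc, hcert, hquit⟩ := exists_misbehaviorCert_of_timer hp hτ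
      have hrec := mem_received_endOf_of_not_isLarge hp hq hquit (by simp [Msg.IsLarge]) hΔS
      rw [htime, add_right_comm]
      exact reached_succ_of_misbehaviorCert hcard hΔS.le hq (hsync hl)
        (hcert.of_quitEpoch hrec) hc

theorem exists_silence [Fintype R] (hcard : P.f + 1 ≤ Fintype.card R) (hΔS : 0 ≤ P.ΔS)
    (hp : p ∈ honest) (hi : (X.state i p).Reached e)
    (hstay : ∀ j, ¬ (X.state j p).Reached (e + 1)) :
    ∃ j t, (.silence e p, t) ∈ (X.state j p).outbox := by
  obtain ⟨k, -, hold, hnew⟩ := exists_start hp hi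
  obtain ⟨m, hm, hev, -⟩ := exists_timeout hp (epochStart hp hold hnew).mem_timers_certificate
  have hreach : (X.state m p).Reached e := reached_mono hp hm hnew
  have hend : m ≤ X.endOf (X.time m) := (lt_endOf.2 le_rfl).le
  rcases (reachable hp m).status_eq_or_exists_blockCert hcard hreach with
    hact | hnot | ⟨c, hc, hcert⟩
  · have he : (X.state m p).epoch = e := hreach.succ_or_epoch_eq.resolve_left (hstay m)
    have hstate := (X.timeout_step m p hp _ hev).2
    simp only [Protocol.timeoutStep, Protocol.onTimeout, he, hact, and_self, if_true] at hstate
    exact ⟨m + 1, X.time m, hstate ▸ Set.mem_insert _ _⟩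
  · obtain ⟨c, hc, hcert⟩ := (reachable hp m).exists_misbehaviorCert hnot
    exact absurd (reached_succ_of_misbehaviorCert hcard hΔS hp (reached_mono hp hend hreach)
      (hcert.mono (received_mono hp hend)) hc) (hstay _)
  · exact absurd (reached_succ_of_blockCert hp (reached_mono hp hend hreach)
      (hcert.mono (received_mono hp hend)) hc) (hstay _)

theorem eventually_received (hp : p ∈ honest) (hq : q ∈ honest)
    (hm : (m, t) ∈ (X.state i p).outbox) :
    ∀ᶠ T in atTop, m ∈ (X.state (X.endOf T) q).received := by
  filter_upwards [eventually_ge_atTop (P.deadline GST m t), eventually_ge_atTop (X.time i)]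
    with T hdeadline htime
  exact mem_received_endOf hp hq hm hdeadline (lt_endOf.2 htime).le

theorem eventually_reached (hp : p ∈ honest) (hi : (X.state i p).Reached e) :
    ∀ᶠ T in atTop, (X.state (X.endOf T) p).Reached e := by
  filter_upwards [eventually_ge_atTop (X.time i)] with T hT
  exact reached_mono hp (lt_endOf.2 hT).le hi

theorem exists_reached [Fintype R] (hM : HonestMajority P honest) (hΔS : 0 < P.ΔS) (e : ℕ)
    (hp : p ∈ honest) : ∃ i, (X.state i p).Reached e := by
  induction e generalizing p with
  | zero =>
    obtain ⟨t₀, hboot⟩ := X.exists_bootstrap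
    obtain ⟨k, -, hk, -⟩ := hboot p hp
    exact ⟨k + 1, hk⟩
  | succ e ih =>
    suffices hsome : ∃ q ∈ honest, ∃ i, (X.state i q).Reached (e + 1) by
      obtain ⟨q, hq, i, hi⟩ := hsome
      obtain ⟨k, -, -, hk⟩ := exists_start hq hi
      exact ⟨_, reached_sync hM.f_lt_card hΔS hq hp hk⟩
    by_contra! hstay
    obtain ⟨i, hi⟩ := ih hp
    have hsilence : ∀ᶠ T in atTop, ∀ q : R, q ∈ honest →
        .silence e q ∈ (X.state (X.endOf T) p).received := by
      rw [eventually_all]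
      intro q
      rw [eventually_imp_distrib_left]
      intro hq
      obtain ⟨j, hj⟩ := ih hq
      obtain ⟨k, t, hsil⟩ := exists_silence hM.f_lt_card hΔS.le hq hj (hstay q hq)
      exact eventually_received hq hp hsil
    obtain ⟨T, hT, hreach⟩ := (hsilence.and (eventually_reached hp hi)).exists
    exact hstay p hp _ (reached_succ_of_misbehaviorCert hM.f_lt_card hΔS.le hp hreach
      (c := .silence e honest.toFinite.toFinset)
      ⟨hM.f_lt_card_honest, .inr fun q hq => hT q (by simpa using hq)⟩ rfl)

/-! ### Votes -/

theorem not_voted_of_timer (hp : p ∈ honest) (hτ : (.epochChange e, x) ∈ (X.state i p).timers) :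
    (.vote e d p, t) ∉ (X.state i p).outbox := by
  induction i generalizing d t with
  | zero => simp [X.state_zero p hp, LocalState.init]
  | succ i ih =>
    intro hv
    have hr := reachable (X := X) hp i
    have hstep := X.localStep hp i
    rcases hstep.mem_timers_epochChange hτ with hτ₀ | ⟨-, -, -, -, he, hnew⟩
    · have hle := hr.leader_of_timer hτ₀
      obtain ⟨b, bc, rfl, -, -, hvote⟩ := hstep.exists_voteOrigin hr (ih hτ₀) hv
      cases hvote with
      | accepted _ _ _ _ _ hvote =>
        rw [hle] at hvote
        obtain ⟨t', ht'⟩ := authentic_of_mem_received hp hvote hp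
        exact ih hτ₀ ht'
      | proposedAtOnce hold => exact hold (hr.reached_of_timer hτ₀)
      | proposedLater _ _ hτ₁ hτ' => exact hτ' (hr.timer_unique hτ₀ hτ₁ ▸ hτ)
    · have := (reachable (X := X) hp (i + 1)).hasVoted_of_vote (he ▸ hv)
      simp [hnew] at this

theorem not_voted_succ (hp : p ∈ honest) (hd : (.vote e d p, t) ∈ (X.state i p).outbox)
    (hold : (.vote e d' p, t') ∉ (X.state i p).outbox) :
    (.vote e d' p, t') ∉ (X.state (i + 1) p).outbox := by
  intro hnew
  have hr := reachable (X := X) hp i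
  obtain ⟨b, bc, -, -, -, hvote⟩ := (X.localStep hp i).exists_voteOrigin hr hold hnew
  cases hvote with
  | accepted _ he hfresh => simp [hr.hasVoted_of_vote (he ▸ hd)] at hfresh
  | proposedAtOnce hreach => exact hreach (hr.reached_of_vote hd)
  | proposedLater _ _ hτ => exact not_voted_of_timer hp hτ hd

theorem vote_unique (hp : p ∈ honest) (hd : (.vote e d p, t) ∈ (X.state i p).outbox)
    (hd' : (.vote e d' p, t') ∈ (X.state i p).outbox) : d = d' := by
  induction i with
  | zero => simp [X.state_zero p hp, LocalState.init] at hd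
  | succ i ih =>
    by_cases hold : (.vote e d p, t) ∈ (X.state i p).outbox <;>
      by_cases hold' : (.vote e d' p, t') ∈ (X.state i p).outbox
    · exact ih hold hold'
    · exact absurd hd' (not_voted_succ hp hold hold')
    · exact absurd hd (not_voted_succ hp hold' hold)
    · exact (X.localStep hp i).vote_unique hold hd hold' hd'

theorem exists_leader_vote (hp : p ∈ honest) (hl : P.leader e ∈ honest)
    (hv : (.vote e d p, t) ∈ (X.state i p).outbox) :
    ∃ t', (.vote e d (P.leader e), t') ∈ (X.state i (P.leader e)).outbox := by
  obtain ⟨k, hk, hold, hnew, -⟩ := exists_broadcast hp hv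
  obtain ⟨b, bc, rfl, -, -, hvote⟩ :=
    (X.localStep hp k).exists_voteOrigin (reachable hp k) hold hnew
  cases hvote with
  | accepted _ _ _ _ _ hvote =>
    exact (authentic_of_mem_received hp hvote hl).imp fun t ht => outbox_mono hl hk.le ht
  | proposedAtOnce _ hprop => exact ⟨t, hprop.1 ▸ hv⟩
  | proposedLater hlead => exact ⟨t, hlead ▸ hv⟩

theorem exists_valid_of_vote [Fintype R] (A : Assumptions P honest) (hp : p ∈ honest)
    (hv : (.vote e d p, t) ∈ (X.state i p).outbox) : ∃ a, P.valid a ∧ P.id a = d := by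
  induction i generalizing p e d t with
  | zero => simp [X.state_zero p hp, LocalState.init] at hv
  | succ i ih =>
    by_cases hold : (.vote e d p, t) ∈ (X.state i p).outbox
    · exact ih hp hold
    have hnewBlock (bc : Option (BlockCert R Id))
        (hcert : ∀ c ∈ bc, P.HasBlockCert (X.state i p) c) : P.valid (P.newBlock p e bc) := by
      refine A.payload p hp e (bc.map BlockCert.id) fun d hd => ?_
      obtain ⟨c, hc, rfl⟩ := Option.map_eq_some_iff.1 hd
      obtain ⟨q, hq, t, ht⟩ := exists_honest_vote A.toHonestMajority (hcert c hc).1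
        (certSigned_of_hasBlockCert hp (hcert c hc))
      exact ih hq ht
    obtain ⟨b, bc, rfl, -, -, hvote⟩ :=
      (X.localStep hp i).exists_voteOrigin (reachable hp i) hold hv
    cases hvote with
    | accepted _ _ _ hvalid => exact ⟨b, hvalid.1, rfl⟩
    | proposedAtOnce _ _ hb hcert => exact ⟨b, hb ▸ hnewBlock bc hcert, rfl⟩
    | proposedLater _ _ _ _ _ _ hb hcert => exact ⟨b, hb ▸ hnewBlock bc hcert, rfl⟩

/-! ### Epochs with an honest leader -/

/-- No honest replica has signed a silence message of epoch `e` before event `i`. -/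
def NoSilence (X : Execution P honest GST) (e i : ℕ) : Prop :=
  ∀ q ∈ honest, ∀ t, (.silence e q, t) ∉ (X.state i q).outbox

theorem NoSilence.mono (h : X.NoSilence e j) (hij : i ≤ j) : X.NoSilence e i :=
  fun q hq t ht => h q hq t (outbox_mono hq hij ht)

theorem time_le_of_mem_outbox_endOf (hp : p ∈ honest)
    (hm : (m, t) ∈ (X.state (X.endOf T) p).outbox) : t ≤ T := by
  obtain ⟨k, hk, -, -, rfl⟩ := exists_broadcast hp hm
  exact lt_endOf.1 hk

theorem mem_received_of_timeout (hp : p ∈ honest) (hq : q ∈ honest)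
    (hev : X.event i = .timeout p τ) (hm : (m, t) ∈ (X.state (X.endOf T) q).outbox)
    (hsmall : ¬ m.IsLarge) (hΔS : 0 < P.ΔS) (hT : T + P.ΔS ≤ X.time i) :
    m ∈ (X.state i p).received := by
  have ht : t ≤ T := time_le_of_mem_outbox_endOf hq hm
  refine X.delivery_before_timeout i q hq p hp m t τ
    (outbox_mono hq (endOf_le (by linarith)) hm) hev ?_
  rw [P.deadline_of_not_isLarge hsmall]
  linarith

theorem exists_start_of_certificate_timer (hp : p ∈ honest)
    (hτ : (.certificate e, x) ∈ (X.state i p).timers) :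
    ∃ k, x = X.time k + P.timeoutCertificate ∧ (X.state (k + 1) p).Reached e := by
  obtain ⟨k, hold, hnew⟩ := Nat.exists_not_and_succ_of_not_zero_of_exists
    (p := fun i => (Timer.certificate e, x) ∈ (X.state i p).timers)
    (by simp [X.state_zero p hp, LocalState.init]) ⟨i, hτ⟩
  obtain ⟨hx, -, hk⟩ := ((X.localStep hp k).mem_timers_certificate hnew).resolve_left hold
  exact ⟨k, hx, hk⟩

theorem exists_start_of_epochChange_timer (hp : p ∈ honest)
    (hτ : (.epochChange e, x) ∈ (X.state i p).timers) :
    ∃ k, x = X.time k + P.timeoutEpochChange ∧ (X.state (k + 1) p).Reached e := by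
  obtain ⟨k, hold, hnew⟩ := Nat.exists_not_and_succ_of_not_zero_of_exists
    (p := fun i => (Timer.epochChange e, x) ∈ (X.state i p).timers)
    (by simp [X.state_zero p hp, LocalState.init]) ⟨i, hτ⟩
  obtain ⟨hx, -, -, hs, he, -⟩ :=
    ((X.localStep hp k).mem_timers_epochChange hnew).resolve_left hold
  exact ⟨k, hx, hs, he.ge⟩

theorem AfterGST.le_time (hG : X.AfterGST e) (hp : p ∈ honest)
    (hi : (X.state (i + 1) p).Reached e) : GST ≤ X.time i := by
  obtain ⟨k, hk, hold, hnew⟩ := exists_start hp hi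
  refine (hG p hp k ⟨fun h => hold ⟨h.1, h.2.ge⟩, hnew.1, ?_⟩).trans
    (X.time_mono (Nat.lt_succ_iff.1 hk))
  exact (epochStart hp hold hnew).epoch_eq

theorem lockedBC_eq (hp : p ∈ honest) (hne : P.leader e ≠ p) (hij : i ≤ j)
    (hi : (X.state i p).Reached e) (hj : (X.state j p).epoch = e) :
    (X.state j p).lockedBC = (X.state i p).lockedBC := by
  induction j, hij using Nat.le_induction with
  | base => rfl
  | succ j hij ih =>
    have hreach := reached_mono hp hij hi
    have he : (X.state j p).epoch = e :=
      le_antisymm (hj ▸ (X.localStep hp j).epoch_le hreach.1) hreach.2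
    rw [← ih he]
    exact (X.localStep hp j).lockedBC_eq (hj.trans he.symm) (he ▸ hne)

/-- In event `k` the leader of epoch `e` proposes with the certificate `bc`, because its waiting
time in the epoch is over. -/
structure ProposesOnTimeout (X : Execution P honest GST) (e k : ℕ)
    (bc : Option (BlockCert R Id)) : Prop where
  event_eq : X.event k = .timeout (P.leader e) (.epochChange e)
  mem_timers : (.epochChange e, X.time k) ∈ (X.state k (P.leader e)).timers
  epoch_eq : (X.state k (P.leader e)).epoch = e
  cert_eq : (X.state k (P.leader e)).lockedBC = bc

section Fintype

variable [Fintype R]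

namespace NoSilence

theorem epoch_ne_of_misbehaviorCert {c : Cert R Id} (hn : X.NoSilence e i)
    (hM : HonestMajority P honest) (hl : P.leader e ∈ honest) (hp : p ∈ honest)
    (hc : P.HasMisbehaviorCert (X.state i p) c) : c.epoch ≠ e := by
  rintro rfl
  have hsigned := certSigned_of_hasMisbehaviorCert hp hc
  cases c with
  | block c => exact hc
  | silence e S =>
    obtain ⟨q, hq, hhonest⟩ := hM.exists_mem_honest hc.1
    obtain ⟨t, ht⟩ := hsigned q hq hhonest
    exact hn q hhonest t ht
  | equiv e d d' =>
    obtain ⟨t, ht⟩ := hsigned.1 hl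
    obtain ⟨t', ht'⟩ := hsigned.2 hl
    exact hc.1 (vote_unique hl ht ht')

theorem exists_blockCert_of_start (hn : X.NoSilence e i) (hM : HonestMajority P honest)
    (hl : P.leader e ∈ honest) (hp : p ∈ honest) (hi : ¬ (X.state i p).Reached (e + 1))
    (hi' : (X.state (i + 1) p).Reached (e + 1)) :
    (X.state i p).Reached e ∧ ∃ c, c.epoch = e ∧ P.HasBlockCert (X.state i p) c ∧
      (.quitEpoch (.block c), X.time i) ∈ (X.state (i + 1) p).outbox ∧
      (X.state (i + 1) p).lockedBC = some c ∧
      ((X.state i p).status e = some .active →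
        (.commit e (some c.id), X.time i + P.timeoutCommit) ∈ (X.state (i + 1) p).timers) := by
  obtain ⟨hreach, hcert | hτ⟩ := (epochStart hp hi hi').exists_blockCert_or_timer (reachable hp i)
  · exact ⟨hreach, hcert⟩
  · obtain ⟨k, hk, -, -, c, hc, hcert, -⟩ := exists_misbehaviorCert_of_timer hp hτ
    exact absurd hc ((hn.mono hk.le).epoch_ne_of_misbehaviorCert hM hl hp hcert)

theorem status_eq (hn : X.NoSilence e i) (hM : HonestMajority P honest)
    (hl : P.leader e ∈ honest) (hp : p ∈ honest) (hi : (X.state i p).Reached e) :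
    (X.state i p).status e = some .active ∨ (X.state i p).status e = some .committed := by
  rcases hstatus : (X.state i p).status e with _ | _ | _ | _
  · exact absurd (((reachable hp i).status_eq_none_iff hi.1).1 hstatus) hi.2.not_gt
  · exact .inl rfl
  · exact .inr rfl
  · obtain ⟨c, hc, hcert⟩ := (reachable hp i).exists_misbehaviorCert hstatus
    exact absurd hc (hn.epoch_ne_of_misbehaviorCert hM hl hp hcert)

end NoSilence

theorem exists_leader_vote_of_blockCert (hM : HonestMajority P honest)
    (hl : P.leader e ∈ honest) (hp : p ∈ honest) (hcert : P.HasBlockCert (X.state i p) c)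
    (hc : c.epoch = e) :
    ∃ t, (.vote e c.id (P.leader e), t) ∈ (X.state i (P.leader e)).outbox := by
  subst hc
  obtain ⟨q, hq, t, ht⟩ := exists_honest_vote hM hcert.1 (certSigned_of_hasBlockCert hp hcert)
  exact exists_leader_vote hq hl ht

theorem NoSilence.exists_leader_vote_endOf (hn : X.NoSilence e (X.endOf T))
    (hM : HonestMajority P honest) (hΔS : 0 ≤ P.ΔS) (hl : P.leader e ∈ honest)
    (hk : ¬ (X.state k (P.leader e)).Reached e) (hk' : (X.state (k + 1) (P.leader e)).Reached e)
    (hT : X.time k + P.timeoutEpochChange ≤ T) :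
    ∃ d t, (.vote e d (P.leader e), t) ∈ (X.state (X.endOf T) (P.leader e)).outbox := by
  have hwait : 0 ≤ P.timeoutEpochChange := by unfold Protocol.timeoutEpochChange; linarith
  rcases (epochStart hl hk hk').exists_propose_or_mem_timers rfl with ⟨b, bc, hb⟩ | hτ
  · exact ⟨_, _, outbox_mono hl (lt_endOf.2 (by linarith)) ((reachable hl _).vote_of_propose hb)⟩
  obtain ⟨j, hj, hev, htime⟩ := exists_timeout hl hτ
  have hjT : j < X.endOf T := lt_endOf.2 (htime.trans_le hT)
  rcases (reached_mono hl hj hk').succ_or_epoch_eq with hsucc | he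
  · obtain ⟨l, hlj, hold, hnew⟩ := exists_start hl hsucc
    obtain ⟨-, c, hc, hcert, -⟩ :=
      (hn.mono (hlj.trans hjT).le).exists_blockCert_of_start hM hl hl hold hnew
    obtain ⟨t, ht⟩ := exists_leader_vote_of_blockCert hM hl hl hcert hc
    exact ⟨_, t, outbox_mono hl (hlj.trans hjT).le ht⟩
  · have hstate := (X.timeout_step j _ hl _ hev).2
    simp only [Protocol.timeoutStep, Protocol.onTimeout, he, if_true, Protocol.propose_eq]
      at hstate
    exact ⟨P.id (P.newBlock (P.leader e) e (X.state j (P.leader e)).lockedBC), X.time j,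
      outbox_mono hl hjT (by rw [hstate]; exact Set.mem_insert _ _)⟩

theorem exists_proposal_of_leader_vote (A : Assumptions P honest) (hl : P.leader e ∈ honest)
    (hv : (.vote e d (P.leader e), t) ∈ (X.state i (P.leader e)).outbox) :
    ∃ k < i, t = X.time k ∧ (X.state (k + 1) (P.leader e)).Reached e ∧ ∃ b bc, d = P.id b ∧
      P.ValidProposal b bc ∧ (.propose e b bc, t) ∈ (X.state (k + 1) (P.leader e)).outbox ∧
      (P.ProposesAtOnce (P.leader e) e bc ∨ X.ProposesOnTimeout e k bc) := by
  obtain ⟨k, hk, hold, hnew, htime⟩ := exists_broadcast hl hv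
  have hr := reachable (X := X) hl k
  obtain ⟨b, bc, rfl, hprop, -, hvote⟩ := (X.localStep hl k).exists_voteOrigin hr hold hnew
  have hvalid (hcert : ∀ c ∈ bc, P.HasBlockCert (X.state k (P.leader e)) c) :
      P.ValidProposal b bc := by
    obtain ⟨a, ha, hid⟩ := exists_valid_of_vote A hl hv
    exact ⟨A.id_injective hid ▸ ha, hvote.prev_eq, fun c hc => (hcert c hc).1⟩
  refine ⟨k, hk, htime, (reachable hl _).reached_of_vote hnew, b, bc, rfl, ?_⟩
  cases hvote with
  | accepted _ he hfresh _ _ hvote =>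
    obtain ⟨t', ht'⟩ := authentic_of_mem_received hl hvote hl
    have hvoted := hr.hasVoted_of_vote (d := P.id b) (q := P.leader e) (t := t') (by rwa [he])
    simp [hvoted] at hfresh
  | proposedAtOnce _ hp _ hcert => exact ⟨hvalid hcert, hprop, .inl hp⟩
  | proposedLater _ hev hτ _ he hbc _ hcert =>
    exact ⟨hvalid hcert, hprop, .inr ⟨hev, hτ, he, hbc.symm⟩⟩

/-- All honest replicas start the epoch within `ΔS` of its leader, which receives their locks within
`ΔS` more: this is why the leader waits for `2 ΔS`. -/
theorem ProposesOnTimeout.lockLE (h : X.ProposesOnTimeout e k bc) (hcard : P.f + 1 ≤ Fintype.card R)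
    (hΔS : 0 < P.ΔS) (hl : P.leader e ∈ honest) (hq : q ∈ honest) (hne : P.leader e ≠ q)
    (hkj : k ≤ j) (hj : (X.state j q).epoch = e)
    (hold : ∀ c ∈ (X.state j q).lockedBC, c.epoch < e) : LockLE (X.state j q).lockedBC bc := by
  obtain ⟨hev, hτ, he, rfl⟩ := h
  obtain ⟨n, htime, hn⟩ := exists_start_of_epochChange_timer hl hτ
  rw [Protocol.timeoutEpochChange] at htime
  have hreach := reached_sync hcard hΔS hl hq hn
  have hle : X.endOf (X.time n + P.ΔS) ≤ k := endOf_le (by linarith)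
  have hlock := lockedBC_eq hq hne (hle.trans hkj) hreach hj
  rcases hc₀ : (X.state j q).lockedBC with _ | c₀
  · exact .inl rfl
  rw [hlock] at hc₀
  obtain ⟨t, ht⟩ := (reachable hq _).exists_quitEpoch_lockedBC hc₀
  have hcert := ((reachable hq _).hasBlockCert_lockedBC hc₀).of_quitEpoch
    (mem_received_of_timeout hl hq hev ht (by simp [Msg.IsLarge]) hΔS (by linarith))
  by_contra hlt
  refine X.react_before_timeout k _ hl _ hev ⟨_, .blockCertLeader c₀
    ((reachable hl k).started_of_timer hτ) hcert ?_ (by rw [he]) fun c hc => ?_⟩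
  · rw [he]
    exact (hold c₀ (hlock.trans hc₀)).ne
  · exact not_le.1 fun hle => hlt (.inr ⟨c₀, c, rfl, hc, hle⟩)

theorem NoSilence.epoch_eq_endOf (hn : X.NoSilence e i) (hM : HonestMajority P honest)
    (hΔS : 0 < P.ΔS) (hl : P.leader e ∈ honest) (hp : p ∈ honest) (hq : q ∈ honest)
    (hev : X.event i = .timeout p τ)
    (hcert : ∀ c, P.HasBlockCert (X.state i p) c → c.epoch ≠ e) (hT : T + P.ΔS ≤ X.time i)
    (hreach : (X.state (X.endOf T) q).Reached e) : (X.state (X.endOf T) q).epoch = e := by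
  refine hreach.succ_or_epoch_eq.resolve_left fun hsucc => ?_
  obtain ⟨k, hk, hold, hnew⟩ := exists_start hq hsucc
  have hki : k ≤ i := hk.le.trans (endOf_le (by linarith))
  obtain ⟨-, c, hc, hhas, hquit, -⟩ :=
    (hn.mono hki).exists_blockCert_of_start hM hl hq hold hnew
  exact hcert c (hhas.of_quitEpoch (mem_received_of_timeout hp hq hev (outbox_mono hq hk hquit)
    (by simp [Msg.IsLarge]) hΔS hT)) hc

theorem epoch_lt_of_lockedBC_endOf (hM : HonestMajority P honest)
    (hin : ∀ q ∈ honest, X.InEpoch q e (X.endOf T)) (hq : q ∈ honest)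
    (hlock : (X.state (X.endOf T) q).lockedBC = some c) : c.epoch < e := by
  have hcert := (reachable hq _).hasBlockCert_lockedBC hlock
  obtain ⟨r, hr, t, ht⟩ := exists_honest_vote hM hcert.1 (certSigned_of_hasBlockCert hq hcert)
  have hle := ((reachable hr _).reached_of_vote ht).2
  rw [(hin r hr).2] at hle
  refine hle.lt_of_ne fun he => not_enabled_endOf (X := X) hq T T ?_
  exact ⟨_, .blockCert c (hin q hq).1 hcert (he.trans (hin q hq).2.symm)⟩

theorem NoSilence.status_eq_active_endOf (hn : X.NoSilence e (X.endOf T))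
    (hM : HonestMajority P honest) (hl : P.leader e ∈ honest) (hq : q ∈ honest)
    (hin : X.InEpoch q e (X.endOf T)) : (X.state (X.endOf T) q).status e = some .active := by
  obtain ⟨hs, he⟩ := hin
  rcases (reachable hq (X.endOf T)).status_eq_or_exists_blockCert hM.f_lt_card ⟨hs, he.ge⟩ with
    h | h | ⟨c, hc, hcert⟩
  · exact h
  · obtain ⟨c, hc, hcert⟩ := (reachable hq _).exists_misbehaviorCert h
    exact absurd hc (hn.epoch_ne_of_misbehaviorCert hM hl hq hcert)
  · exact absurd ⟨_, .blockCert c hs hcert (hc.trans he.symm)⟩ (not_enabled_endOf hq T T)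

theorem NoSilence.exists_vote_endOf (hn : X.NoSilence e (X.endOf T)) (A : Assumptions P honest)
    (hl : P.leader e ∈ honest) (hG : X.AfterGST e)
    (hin : ∀ q ∈ honest, X.InEpoch q e (X.endOf T))
    (hv : (.vote e d (P.leader e), t) ∈ (X.state i (P.leader e)).outbox) (ht : t + P.ΔL ≤ T)
    (hq : q ∈ honest) : ∃ t', (.vote e d q, t') ∈ (X.state (X.endOf T) q).outbox := by
  have hΔS := A.ΔS_pos
  have hΔL := A.ΔS_le
  have hr := reachable (X := X) hq (X.endOf T)
  obtain ⟨hs, he⟩ := hin q hq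
  obtain ⟨k, -, rfl, hk, b, bc, rfl, hvalid, hprop, hprov⟩ := exists_proposal_of_leader_vote A hl hv
  have hkT : k < X.endOf T := lt_endOf.2 (by linarith)
  have hvT : (.vote e (P.id b) (P.leader e), X.time k) ∈
      (X.state (X.endOf T) (P.leader e)).outbox :=
    outbox_mono hl hkT ((reachable hl _).vote_of_propose hprop)
  cases hvoted : (X.state (X.endOf T) q).hasVoted with
  | true =>
    obtain ⟨d, t, hd⟩ := hr.exists_vote hvoted
    rw [he] at hd
    obtain ⟨t', ht'⟩ := exists_leader_vote hq hl hd
    exact ⟨t, vote_unique hl ht' hvT ▸ hd⟩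
  | false =>
    have hne : P.leader e ≠ q := by
      rintro rfl
      have := hr.hasVoted_of_vote (d := P.id b) (q := P.leader e) (t := X.time k) (by rwa [he])
      simp [hvoted] at this
    have hact := hn.status_eq_active_endOf A.toHonestMajority hl hq (hin q hq)
    have hrprop : .propose e b bc ∈ (X.state (X.endOf T) q).received := by
      refine mem_received_endOf hl hq hprop ?_ hkT
      simpa [Protocol.deadline, Msg.IsLarge, max_eq_left (hG.le_time hl hk)] using ht
    have hrvote : .vote e (P.id b) (P.leader e) ∈ (X.state (X.endOf T) q).received := by
      refine mem_received_endOf hl hq hvT ?_ le_rfl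
      rw [P.deadline_of_not_isLarge (by simp [Msg.IsLarge])]
      linarith
    have hlock : LockLE (X.state (X.endOf T) q).lockedBC bc := by
      have hold : ∀ c ∈ (X.state (X.endOf T) q).lockedBC, c.epoch < e := fun c hc =>
        epoch_lt_of_lockedBC_endOf A.toHonestMajority hin hq hc
      exact hprov.elim (fun h => h.lockLE hold)
        fun h => h.lockLE A.f_lt_card hΔS hl hq hne hkT.le he hold
    refine absurd ⟨_, .vote b bc hs ?_ ?_ ?_ hvalid hvoted hlock⟩ (not_enabled_endOf hq T T) <;>
      rwa [he]

/-- The timeout `ΔL + 4 ΔS` leaves `ΔS` for the leader to start the epoch, `2 ΔS` for it to propose,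
`ΔL` for the proposal and `ΔS` for the votes to arrive. -/
theorem noSilence (A : Assumptions P honest) (hl : P.leader e ∈ honest) (hG : X.AfterGST e)
    (i : ℕ) : X.NoSilence e i := by
  have hΔS := A.ΔS_pos
  have hΔL := A.ΔS_le
  have hM := A.toHonestMajority
  induction i with
  | zero => intro q hq; simp [X.state_zero q hq, LocalState.init]
  | succ i ih =>
    intro p hp t ht
    obtain ⟨-, hev, hτ, he⟩ :=
      ((X.localStep hp i).mem_outbox_silence ht).resolve_left (ih p hp t)
    obtain ⟨k, htime, hk⟩ := exists_start_of_certificate_timer hp hτ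
    rw [Protocol.timeoutCertificate] at htime
    have hnocert (c : BlockCert R Id) (hc : P.HasBlockCert (X.state i p) c) : c.epoch ≠ e :=
      fun hce => X.react_before_timeout i p hp _ hev
        ⟨_, .blockCert c ((reachable hp i).started_of_timer hτ) hc (hce.trans he.symm)⟩
    obtain ⟨T, hT⟩ : ∃ T, T = X.time k + 3 * P.ΔS + P.ΔL := ⟨_, rfl⟩
    have hTi : X.endOf T ≤ i := endOf_le (by linarith)
    have hin : ∀ q ∈ honest, X.InEpoch q e (X.endOf T) := fun q hq => by
      have hreach : (X.state (X.endOf T) q).Reached e :=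
        reached_mono hq (endOf_mono (by linarith)) (reached_sync hM.f_lt_card hΔS hp hq hk)
      exact ⟨hreach.1,
        ih.epoch_eq_endOf hM hΔS hl hp hq hev hnocert (by linarith) hreach⟩
    obtain ⟨k', hk', hold, hnew⟩ := exists_start hl (reached_sync hM.f_lt_card hΔS hp hl hk)
    obtain ⟨d, t, hd⟩ := (ih.mono ((endOf_mono (by linarith)).trans hTi)).exists_leader_vote_endOf
      (T := X.time k + 3 * P.ΔS) hM hΔS.le hl hold hnew
      (by rw [Protocol.timeoutEpochChange]; linarith [lt_endOf.1 hk'])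
    have hdT := time_le_of_mem_outbox_endOf hl hd
    refine hnocert ⟨e, d, honest.toFinite.toFinset⟩ ⟨hM.f_lt_card_honest, .inr fun q hq => ?_⟩ rfl
    rw [Set.Finite.mem_toFinset] at hq
    obtain ⟨t', ht'⟩ :=
      (ih.mono hTi).exists_vote_endOf A hl hG hin hd (by linarith) hq
    exact mem_received_of_timeout hp hq hev ht' (by simp [Msg.IsLarge]) hΔS (by linarith)

end Fintype
/-! ### Committing new blocks -/

theorem Proposes.exists_vote (hb : X.Proposes p e b) (hp : p ∈ honest) :
    ∃ i t, (.vote e (P.id b) p, t) ∈ (X.state i p).outbox := by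
  obtain ⟨i, bc, t, hi⟩ := hb
  exact ⟨i, t, (reachable hp i).vote_of_propose hi⟩

theorem Proposes.vote_eq (hb : X.Proposes (P.leader e) e b) (hl : P.leader e ∈ honest)
    (hp : p ∈ honest) (hv : (.vote e d p, t) ∈ (X.state i p).outbox) : d = P.id b := by
  obtain ⟨j, t', hj⟩ := hb.exists_vote hl
  obtain ⟨t, ht⟩ := exists_leader_vote hp hl hv
  exact vote_unique hl (outbox_mono hl (le_max_left i j) ht)
    (outbox_mono hl (le_max_right i j) hj)

theorem decision_mono (hp : p ∈ honest) (hi : (X.state i p).Reached e)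
    (hcom : (X.state i p).status e = some .committed) (hd : (X.state i p).decision e = some d)
    (hij : i ≤ j) : (X.state j p).decision e = some d := by
  suffices h : (X.state j p).status e = some .committed ∧ (X.state j p).decision e = some d from h.2
  induction j, hij using Nat.le_induction with
  | base => exact ⟨hcom, hd⟩
  | succ j hij ih => exact (X.localStep hp j).decision_eq (reached_mono hp hij hi) ih.1 ih.2

/-- The block hashes that honest replicas have voted for before event `i`. These include the hashes
of all blocks committed by then, and they are finitely many. -/
def votedIds (X : Execution P honest GST) (i : ℕ) : Set Id :=
  {d | ∃ q ∈ honest, ∃ e t, (.vote e d q, t) ∈ (X.state i q).outbox}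

theorem votedIds_mono (hij : i ≤ j) : X.votedIds i ⊆ X.votedIds j := by
  rintro d ⟨q, hq, e, t, h⟩
  exact ⟨q, hq, e, t, outbox_mono hq hij h⟩

theorem finite_votedIds [Finite R] (X : Execution P honest GST) (i : ℕ) :
    (X.votedIds i).Finite := by
  have hvotes (q : R) (hq : q ∈ honest) :
      {d | ∃ e t, (.vote e d q, t) ∈ (X.state i q).outbox}.Finite := by
    have hinj : Function.Injective
        fun v : ℕ × Id × ℝ => ((.vote v.1 v.2.1 q, v.2.2) : Msg R Payload Id × ℝ) := by
      rintro ⟨e, d, t⟩ ⟨e', d', t'⟩ h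
      simpa [and_assoc] using h
    refine (((finite_outbox (X := X) hq i).preimage hinj.injOn).image fun v => v.2.1).subset ?_
    rintro d ⟨e, t, h⟩
    exact ⟨(e, d, t), h, rfl⟩
  refine (honest.toFinite.biUnion hvotes).subset ?_
  rintro d ⟨q, hq, h⟩
  exact Set.mem_biUnion hq h

theorem eventually_afterGST [Finite R] (X : Execution P honest GST) :
    ∀ᶠ e in atTop, X.AfterGST e := by
  cases nonempty_fintype R
  filter_upwards [eventually_gt_atTop
    (Finset.univ.sup fun q => (X.state (X.endOf GST) q).epoch)] with e he q hq i hstart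
  obtain ⟨-, hs, hi⟩ := hstart
  by_contra! hlt
  have hreach : (X.state (X.endOf GST) q).Reached e :=
    reached_mono hq (lt_endOf.2 hlt.le) ⟨hs, hi.ge⟩
  have hle := Finset.le_sup (f := fun q => (X.state (X.endOf GST) q).epoch) (Finset.mem_univ q)
  exact (he.trans_le hreach.2).not_ge hle

section Fintype

variable [Fintype R]

theorem exists_proposes (A : Assumptions P honest) (hl : P.leader e ∈ honest)
    (hG : X.AfterGST e) : ∃ b, X.Proposes (P.leader e) e b := by
  have hM := A.toHonestMajority
  obtain ⟨i, hi⟩ := exists_reached (X := X) hM A.ΔS_pos (e + 1) hl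
  obtain ⟨k, -, hold, hnew⟩ := exists_start hl hi
  obtain ⟨-, c, hc, hcert, -⟩ :=
    (noSilence A hl hG k).exists_blockCert_of_start hM hl hl hold hnew
  obtain ⟨t, ht⟩ := exists_leader_vote_of_blockCert hM hl hl hcert hc
  obtain ⟨m, -, -, -, b, bc, -, -, hprop, -⟩ := exists_proposal_of_leader_vote A hl ht
  exact ⟨b, m + 1, bc, t, hprop⟩

theorem exists_committed (A : Assumptions P honest) (hl : P.leader e ∈ honest)
    (hG : X.AfterGST e) (hp : p ∈ honest) :
    ∃ j, (X.state j p).Reached e ∧ (X.state j p).status e = some .committed := by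
  have hM := A.toHonestMajority
  obtain ⟨i, hi⟩ := exists_reached (X := X) hM A.ΔS_pos (e + 1) hp
  obtain ⟨k, -, hold, hnew⟩ := exists_start hp hi
  obtain ⟨hk, c, -, -, -, -, htimer⟩ :=
    (noSilence A hl hG k).exists_blockCert_of_start hM hl hp hold hnew
  rcases (noSilence A hl hG k).status_eq hM hl hp hk with hact | hcom
  · obtain ⟨m, hm, hev, -⟩ := exists_timeout hp (htimer hact)
    have hreach : (X.state m p).Reached e := reached_mono hp ((Nat.le_succ k).trans hm) hk
    rcases (noSilence A hl hG m).status_eq hM hl hp hreach with hact' | hcom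
    · refine ⟨m + 1, reached_mono hp m.le_succ hreach, ?_⟩
      have hstate := (X.timeout_step m p hp _ hev).2
      simp only [Protocol.timeoutStep, Protocol.onTimeout, hact', if_true] at hstate
      simp [hstate, Protocol.decideEpoch]
    · exact ⟨m, hreach, hcom⟩
  · exact ⟨k, hk, hcom⟩

theorem commitsIn (A : Assumptions P honest) (hl : P.leader e ∈ honest) (hG : X.AfterGST e)
    (hb : X.Proposes (P.leader e) e b) (hp : p ∈ honest) : X.CommitsIn p e b := by
  obtain ⟨j, hreach, hcom⟩ := exists_committed A hl hG hp
  have hr := reachable (X := X) hp j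
  obtain ⟨d, hd⟩ := Option.ne_none_iff_exists'.1 (hr.decision_ne_none hcom)
  obtain ⟨c, hc, rfl, hcert⟩ := hr.exists_blockCert A.f_lt_card hd
  obtain ⟨t, ht⟩ := exists_leader_vote_of_blockCert A.toHonestMajority hl hp hcert hc
  rw [hb.vote_eq hl hl ht] at hd
  obtain ⟨i, bc, t, hprop⟩ := hb
  obtain ⟨T, hT, hjT⟩ :=
    ((eventually_received hl hp hprop).and (eventually_ge_atTop (X.time j))).exists
  have hjT : j ≤ X.endOf T := (lt_endOf.2 hjT).le
  have hdT := decision_mono hp hreach hcom hd hjT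
  refine ⟨X.endOf T, hdT, ?_⟩
  by_contra hnew
  exact not_enabled_endOf hp T T
    ⟨_, .commitBlock e b bc (reached_mono hp hjT hreach).1 hT hdT hnew⟩

theorem exists_lockedBC (A : Assumptions P honest) (hl : P.leader e ∈ honest)
    (hG : X.AfterGST e) (hp : p ∈ honest) (hi : (X.state i p).Reached (e + 1)) :
    ∃ c, (X.state i p).lockedBC = some c ∧ e ≤ c.epoch := by
  induction i with
  | zero => simp [LocalState.Reached, X.state_zero p hp, LocalState.init] at hi
  | succ i ih =>
    by_cases hold : (X.state i p).Reached (e + 1)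
    · obtain ⟨c, hc, hce⟩ := ih hold
      rcases (X.localStep hp i).lockedBC_eq_or_recent with heq | ⟨c', hc', he | hlt⟩
      · exact ⟨c, heq.trans hc, hce⟩
      · exact ⟨c', hc', he ▸ (Nat.le_succ e).trans hold.2⟩
      · exact ⟨c', hc', hce.trans (hlt c hc).le⟩
    · obtain ⟨-, c, hc, -, -, hlock, -⟩ := (noSilence A hl hG i).exists_blockCert_of_start
        A.toHonestMajority hl hp hold hi
      exact ⟨c, hlock, hc.ge⟩

theorem exists_block_of_vote (hM : HonestMajority P honest) (hp : p ∈ honest)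
    (hold : (.vote e d p, t) ∉ (X.state i p).outbox)
    (hnew : (.vote e d p, t) ∈ (X.state (i + 1) p).outbox) :
    ∃ b bc, d = P.id b ∧ b.prev = bc.map BlockCert.id ∧ LockLE (X.state (i + 1) p).lockedBC bc ∧
      ∀ c ∈ bc, ∃ q ∈ honest, ∃ t, (.vote c.epoch c.id q, t) ∈ (X.state i q).outbox := by
  obtain ⟨b, bc, hd, -, hlock, horigin⟩ :=
    (X.localStep hp i).exists_voteOrigin (reachable hp i) hold hnew
  refine ⟨b, bc, hd, horigin.prev_eq, hlock, fun c hc => ?_⟩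
  cases horigin with
  | accepted _ _ _ hvalid hprop =>
    exact exists_honest_vote hM (hvalid.2.2 c hc) (authentic_of_mem_received hp hprop c hc)
  | proposedAtOnce _ _ _ hcert | proposedLater _ _ _ _ _ _ _ hcert =>
    exact exists_honest_vote hM (hcert c hc).1 (certSigned_of_hasBlockCert hp (hcert c hc))

theorem Proposes.extends_of_vote (hb : X.Proposes (P.leader e) e b) (A : Assumptions P honest)
    (hl : P.leader e ∈ honest) (hG : X.AfterGST e) (he : e < e') (hp : p ∈ honest)
    (hv : (.vote e' d p, t) ∈ (X.state i p).outbox) :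
    ∃ a, P.id a = d ∧ Relation.TransGen P.Parent b a := by
  induction i generalizing p e' d t with
  | zero => simp [X.state_zero p hp, LocalState.init] at hv
  | succ i ih =>
    by_cases hold : (.vote e' d p, t) ∈ (X.state i p).outbox
    · exact ih he hp hold
    obtain ⟨a, bc, rfl, hprev, hlock, hbc⟩ := exists_block_of_vote A.toHonestMajority hp hold hv
    obtain ⟨c₀, hc₀, hle₀⟩ :=
      exists_lockedBC A hl hG hp (((reachable hp _).reached_of_vote hv).of_le he)
    obtain ⟨c₁, c, hc₁, rfl, hle⟩ := hlock.resolve_left (by simp [hc₀])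
    obtain rfl : c₀ = c₁ := Option.some.inj (hc₀.symm.trans hc₁)
    obtain ⟨q, hq, t', ht'⟩ := hbc c rfl
    refine ⟨a, rfl, ?_⟩
    rcases (hle₀.trans hle).eq_or_lt with rfl | hlt
    · exact .single (hprev.trans (congrArg some (hb.vote_eq hl hq ht')))
    · obtain ⟨a', ha', hext⟩ := ih hlt hq ht'
      exact hext.tail (hprev.trans (congrArg some ha'.symm))

theorem Proposes.extends_of_lt (hb : X.Proposes (P.leader e) e b)
    (hb' : X.Proposes (P.leader e') e' b') (he : e < e') (A : Assumptions P honest)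
    (hl : P.leader e ∈ honest) (hG : X.AfterGST e) (hl' : P.leader e' ∈ honest) :
    Relation.TransGen P.Parent b b' := by
  obtain ⟨i, t, ht⟩ := hb'.exists_vote hl'
  obtain ⟨a, ha, hext⟩ := hb.extends_of_vote A hl hG he hl' ht
  exact A.id_injective ha ▸ hext

theorem id_mem_votedIds_of_parent (hM : HonestMajority P honest) (hid : Function.Injective P.id)
    (hb : P.id b ∈ X.votedIds i) (hab : P.Parent a b) : P.id a ∈ X.votedIds i := by
  obtain ⟨q, hq, e, t, hv⟩ := hb
  obtain ⟨k, hk, hold, hnew, -⟩ := exists_broadcast hq hv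
  obtain ⟨b', bc, hbb', hprev, -, hbc⟩ := exists_block_of_vote hM hq hold hnew
  obtain rfl := hid hbb'
  obtain ⟨c, hc, hca⟩ := Option.map_eq_some_iff.1 (hprev.symm.trans hab)
  obtain ⟨r, hr, t', ht'⟩ := hbc c hc
  exact ⟨r, hr, c.epoch, t', outbox_mono hr hk.le (hca ▸ ht')⟩

theorem id_mem_votedIds_of_extends (hM : HonestMajority P honest) (hid : Function.Injective P.id)
    (hb : P.id b ∈ X.votedIds i) (hab : P.Extends b a) : P.id a ∈ X.votedIds i := by
  induction hab using Relation.ReflTransGen.head_induction_on with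
  | refl => exact hb
  | head hparent _ ih => exact id_mem_votedIds_of_parent hM hid ih hparent

theorem id_mem_votedIds_of_committed (hM : HonestMajority P honest)
    (hid : Function.Injective P.id) (hp : p ∈ honest) (hb : b ∈ (X.state i p).committed) :
    P.id b ∈ X.votedIds i := by
  induction i with
  | zero => simp [X.state_zero p hp, LocalState.init] at hb
  | succ i ih =>
    refine votedIds_mono i.le_succ ?_
    rcases (X.localStep hp i).mem_committed hb with hold | ⟨e, b', hd, hext⟩
    · exact ih hold
    · obtain ⟨c, -, hc, hcert⟩ := (reachable hp i).exists_blockCert hM.f_lt_card hd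
      obtain ⟨q, hq, t, ht⟩ := exists_honest_vote hM hcert.1
        (certSigned_of_hasBlockCert hp hcert)
      exact id_mem_votedIds_of_extends hM hid ⟨q, hq, c.epoch, t, hc ▸ ht⟩ hext

theorem exists_commitsNew_of_notMem (A : Assumptions P honest) (hl : P.leader e ∈ honest)
    (hG : X.AfterGST e) (hb : X.Proposes (P.leader e) e b)
    (hnew : P.id b ∉ X.votedIds (X.endOf T)) (hp : p ∈ honest) :
    ∃ i, T ≤ X.time i ∧ X.CommitsNew p b i := by
  have hnew : b ∉ (X.state (X.endOf T) p).committed :=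
    mt (id_mem_votedIds_of_committed A.toHonestMajority A.id_injective hp) hnew
  obtain ⟨i, -, hi⟩ := commitsIn A hl hG hb hp
  obtain ⟨k, hold, hk⟩ := Nat.exists_not_and_succ_of_not_zero_of_exists
    (p := fun k => b ∈ (X.state k p).committed)
    (fun h => hnew (committed_mono hp (Nat.zero_le _) h)) ⟨i, hi⟩
  refine ⟨k, le_of_lt (not_le.1 fun hle => ?_), hold, hk⟩
  exact hnew (committed_mono hp (lt_endOf.2 hle) hk)

theorem exists_proposes_notMem (A : Assumptions P honest)
    (hacyclic : ∀ b, ¬ Relation.TransGen P.Parent b b)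
    (hinf : ∃ᶠ e in atTop, P.leader e ∈ honest) {S : Set Id} (hS : S.Finite) :
    ∃ e b, P.leader e ∈ honest ∧ X.AfterGST e ∧ X.Proposes (P.leader e) e b ∧ P.id b ∉ S := by
  have hE : {e | P.leader e ∈ honest ∧ X.AfterGST e}.Infinite :=
    Nat.frequently_atTop_iff_infinite.1 (hinf.and_eventually X.eventually_afterGST)
  have hprop (e : {e | P.leader e ∈ honest ∧ X.AfterGST e}) :
      ∃ b, X.Proposes (P.leader e) e b := exists_proposes A e.2.1 e.2.2
  choose block hblock using hprop
  have hinj : Function.Injective fun e => P.id (block e) := by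
    refine Function.Injective.of_lt_imp_ne fun e e' hlt hid => ?_
    have hext := (hblock e).extends_of_lt (hblock e') hlt A e.2.1 e.2.2 e'.2.1
    exact hacyclic _ (A.id_injective hid ▸ hext)
  have := hE.to_subtype
  obtain ⟨_, ⟨e, rfl⟩, hnew⟩ := (Set.infinite_range_of_injective hinj).exists_notMem_finite hS
  exact ⟨e, block e, e.2.1, e.2.2, hblock e, hnew⟩

end Fintype
end Execution

end AlterBFT

theorem mainTheorem2 {R Payload Id : Type*} [Fintype R]
    (P : AlterBFT.Protocol R Payload Id) (honest : Set R) (GST : ℝ)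
    (hn : 2 * P.f < Fintype.card R)
    (hfaulty : honestᶜ.ncard ≤ P.f)
    (hΔS : 0 < P.ΔS) (hΔL : P.ΔS ≤ P.ΔL)
    (hid : Function.Injective P.id)
    (hacyclic : ∀ b, ¬ Relation.TransGen P.Parent b b)
    (hpayload : ∀ p ∈ honest, ∀ e prev, (∀ h ∈ prev, ∃ a, P.valid a ∧ P.id a = h) →
      P.valid ⟨P.getPayload p e prev, prev⟩)
    (X : AlterBFT.Execution P honest GST) :
    (∀ e, P.leader e ∈ honest → X.AfterGST e →
      (∃ b, X.Proposes (P.leader e) e b) ∧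
      ∀ b, X.Proposes (P.leader e) e b → ∀ p ∈ honest, X.CommitsIn p e b) ∧
    ((∀ E, ∃ e, E ≤ e ∧ P.leader e ∈ honest) →
      ∀ p ∈ honest, ∀ T : ℝ, ∃ i b, T ≤ X.time i ∧ X.CommitsNew p b i) := by
  have A : AlterBFT.Assumptions P honest := ⟨⟨hn, hfaulty⟩, hΔS, hΔL, hid, hpayload⟩
  refine ⟨fun e hl hG => ⟨AlterBFT.Execution.exists_proposes A hl hG, fun b hb p hp =>
    AlterBFT.Execution.commitsIn A hl hG hb hp⟩, fun hinf p hp T => ?_⟩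
  obtain ⟨e, b, hl, hG, hb, hnew⟩ := AlterBFT.Execution.exists_proposes_notMem A hacyclic
    (frequently_atTop.2 hinf) (X.finite_votedIds (X.endOf T))
  obtain ⟨i, hi⟩ := AlterBFT.Execution.exists_commitsNew_of_notMem A hl hG hb hnew hp
  exact ⟨i, b, hi⟩
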